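/- Let $d \ge 1$, let $\phi$ be the standard univariate normal density, and let $\mathcal F_d$ be the class of all densities on $\mathbb R^d$ of the form \[ (x_1,\dots,x_d) \mapsto \int \phi(x_1-u_1)\cdots\phi(x_d-u_d)\, dG(u_1,\dots,u_d), \] where $G$ is an arbitrary (Borel) probability measure on $\mathbb R^d$. For $n \ge 2$ let \[ R_n(\mathcal F_d, L^2) := \inf_{\hat f_n}\ \sup_{f \in \mathcal F_d} \mathbb E_f \int_{\mathbb R^d} \bigl(\hat f_n(x) - f(x)\bigr)^2\, dx \] be the minimax risk under squared $L^2$ loss, where $\mathbb E_f$ is the expectation when $X_1,\dots,X_n$ are i.i.d. with density $f$, and the infimum is over all estimators $\hat f_n(x) = \hat f_n(X_1,\dots,X_n; x)$, that is, all real-valued functions that are jointly measurable in $(X_1,\dots,X_n,x)$. Then there exist constants $0 < c_d, C_d < \infty$ depending only on $d$ such that for all $n \ge 2$ \[ c_d\,\frac{(\log n)^{d/2}}{n} \;\le\; R_n(\mathcal F_d, L^2) \;\le\; C_d\,\frac{(\log n)^{d/2}}{n}. \] -/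

import Mathlib

open MeasureTheory ProbabilityTheory
open scoped ENNReal

noncomputable section

/-- The Gaussian location mixture density on `ℝ^d` with mixing measure `G`:
`x ↦ ∫ φ(x₁ - u₁) ⋯ φ(x_d - u_d) dG(u)`, with `φ` the standard normal density.
Here `ℝ^d` is `Fin d → ℝ` with its Borel σ-algebra and Lebesgue measure `volume`; no norm is used. -/
def gaussianMixture {d : ℕ} (G : Measure (Fin d → ℝ)) (x : Fin d → ℝ) : ℝ :=
  ∫ u, ∏ i, gaussianPDFReal 0 1 (x i - u i) ∂G

/-- The class of all Gaussian location mixture densities on `ℝ^d`. -/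
def gaussianMixtureClass (d : ℕ) : Set ((Fin d → ℝ) → ℝ) :=
  {f | ∃ G : Measure (Fin d → ℝ), IsProbabilityMeasure G ∧ f = gaussianMixture G}

/-- The squared `L²` distance `∫ (f(x) - g(x))² dx`, with value `∞` if the integral diverges. -/
def sqL2Loss {d : ℕ} (f g : (Fin d → ℝ) → ℝ) : ℝ≥0∞ :=
  ∫⁻ x, ENNReal.ofReal ((f x - g x) ^ 2)

/-- The joint law of `n` i.i.d. observations with density `f` on `ℝ^d`. -/
def sampleLaw {d : ℕ} (n : ℕ) (f : (Fin d → ℝ) → ℝ) : Measure (Fin n → Fin d → ℝ) :=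
  Measure.pi fun _ => (volume : Measure (Fin d → ℝ)).withDensity fun x => ENNReal.ofReal (f x)

/-- An estimator of a function on `ℝ^d` from `n` observations: a real-valued function
`(X₁, …, Xₙ, x) ↦ f̂(X₁, …, Xₙ)(x)`, jointly measurable in the sample and the point.
It need not be a density. -/
def IsEstimator {d n : ℕ} (fhat : (Fin n → Fin d → ℝ) → (Fin d → ℝ) → ℝ) : Prop :=
  Measurable (Function.uncurry fhat)

/-- The minimax risk `inf_{f̂} sup_{f ∈ F} E_f loss(f̂(X₁, …, Xₙ), f)`. -/
def densityMinimaxRisk {d : ℕ} (n : ℕ) (F : Set ((Fin d → ℝ) → ℝ))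
    (loss : ((Fin d → ℝ) → ℝ) → ((Fin d → ℝ) → ℝ) → ℝ≥0∞) : ℝ≥0∞ :=
  ⨅ (fhat : (Fin n → Fin d → ℝ) → (Fin d → ℝ) → ℝ) (_ : IsEstimator fhat),
    ⨆ f ∈ F, ∫⁻ X, loss (fhat X) f ∂(sampleLaw n f)

end

/-! The Fourier transform of a Gaussian mixture is the standard Gaussian transform times a function
bounded by 1, so it decays like `exp(-2π²|t|²)`, and only frequencies up to order `√(log n)` matter
at noise level `1/n`. About `(log n)^(d/2)` coefficients are then to be estimated, each at cost
`1/n`.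

Upper bound: the kernel estimator whose frequency response is the indicator of a ball of radius `R`
has variance of order `R^d / n` and squared bias of order `exp(-2π²R²)`, both by Plancherel
(`exists_kernel`). Jensen's inequality reduces the bias of any mixture to that of a single Gaussian
(`lintegral_bias_le`), so the bound is uniform in `G`. The choice `2π²R² = log n` makes the bias of
order `1/n`.

Lower bound: multiplying the mixing law `N(0, I)` by one plus products of sines multiplies the
mixture `N(0, 2I)` by one plus products of sines of half the frequency, damped by a Gaussian factor.
With `M² ≍ log n` and amplitude `b ≍ n^(-1/2)`, that damping can be undone while the mixing density
stays nonnegative (`perturbedDensity_mem`). This gives a hypercube of `M^d` independent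
perturbations, orthogonal on a cube (`exists_sqL2Loss_ge`), whose neighbours are indistinguishable
from `n` samples (`coordRisk_add_coordRisk_update_ge`). Assouad's argument gives risk of order `M^d
b²`. -/

/-! ### Plancherel's theorem for functions in `L¹ ∩ L²` -/

section Plancherel
open FourierTransform SchwartzMap

variable {V : Type*} [NormedAddCommGroup V] [InnerProductSpace ℝ V] [FiniteDimensional ℝ V]
  [MeasurableSpace V] [BorelSpace V]

/-- The `L²` Fourier transform of an integrable function is given by the Fourier integral. -/
theorem coeFn_fourier_toLp_ae_eq {f : V → ℂ} (hf : Integrable f) (hf2 : MemLp f 2) :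
    (𝓕 (hf2.toLp f) : Lp ℂ 2 (volume : Measure V)) =ᵐ[volume] 𝓕 f := by
  have hcont : Continuous (𝓕 f) := VectorFourier.fourierIntegral_continuous
    Real.continuous_fourierChar continuous_inner hf
  -- It suffices to pair with smooth compactly supported `g`. Both transforms can be moved onto `g`:
  -- the `L²` one through tempered distributions, the integral one by Fubini.
  refine ae_eq_of_integral_contDiff_smul_eq
    ((Lp.memLp _).locallyIntegrable (by norm_num)) hcont.locallyIntegrable ?_
  intro g hg hgs
  have hgs' : HasCompactSupport (fun x => (g x : ℂ)) := hgs.comp_left (g := ((↑) : ℝ → ℂ)) rfl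
  have hg' : ContDiff ℝ (⊤ : ℕ∞) (fun x => (g x : ℂ)) := Complex.ofRealCLM.contDiff.comp hg
  set G : 𝓢(V, ℂ) := hgs'.toSchwartzMap hg' with hG
  have hGa : ∀ x, G x = (g x : ℂ) := fun x => rfl
  set F : Lp ℂ 2 (volume : Measure V) := hf2.toLp f with hF
  have h1 := congrArg (fun T => T G) (Lp.fourier_toTemperedDistribution_eq F)
  simp only [TemperedDistribution.fourier_apply, Lp.toTemperedDistribution_apply] at h1
  have h2 : ∫ x, 𝓕 (G : V → ℂ) x • f x = ∫ x, (G x) • 𝓕 f x := by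
    simpa using! VectorFourier.integral_fourierIntegral_smul_eq_flip (L := innerₗ V)
      (μ := volume) (ν := volume) Real.continuous_fourierChar continuous_inner
      (SchwartzMap.integrable (μ := volume) G) hf
  calc ∫ x, g x • (𝓕 F : Lp ℂ 2 (volume : Measure V)) x
      = ∫ x, G x • (𝓕 F : Lp ℂ 2 (volume : Measure V)) x := by simp [hGa]
    _ = ∫ x, (𝓕 G) x • F x := h1.symm
    _ = ∫ x, 𝓕 (G : V → ℂ) x • f x := by
        refine integral_congr_ae ?_
        filter_upwards [hf2.coeFn_toLp] with x hx
        rw [hx, SchwartzMap.fourier_coe]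
    _ = ∫ x, g x • 𝓕 f x := by rw [h2]; simp [hGa]

/-- Plancherel's theorem on `L¹ ∩ L²`. -/
theorem eLpNorm_fourier_eq {f : V → ℂ} (hf : Integrable f) (hf2 : MemLp f 2) :
    eLpNorm (𝓕 f) 2 volume = eLpNorm f 2 volume := by
  rw [← eLpNorm_congr_ae (coeFn_fourier_toLp_ae_eq hf hf2),
    ← eLpNorm_congr_ae hf2.coeFn_toLp, ← Lp.enorm_def, ← Lp.enorm_def,
    ← ofReal_norm, ← ofReal_norm, Lp.norm_fourier_eq]

theorem eLpNorm_fourierInv_eq {f : V → ℂ} (hf : Integrable f) (hf2 : MemLp f 2) :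
    eLpNorm (𝓕⁻ f) 2 volume = eLpNorm f 2 volume := by
  have : 𝓕⁻ f = (𝓕 f) ∘ (fun x => -x) := by
    ext x; exact Real.fourierInv_eq_fourier_neg f x
  rw [this, eLpNorm_comp_measurePreserving (p := 2) (μ := volume) ?_ (Measure.measurePreserving_neg _),
    eLpNorm_fourier_eq hf hf2]
  exact (VectorFourier.fourierIntegral_continuous
    Real.continuous_fourierChar continuous_inner hf).aestronglyMeasurable

/-- Plancherel's theorem for the inverse transform, as an identity of lower integrals. -/
theorem lintegral_enorm_sq_fourierInv_eq {f : V → ℂ} (hf : Integrable f) (hf2 : MemLp f 2) :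
    ∫⁻ x, ‖𝓕⁻ f x‖ₑ ^ 2 = ∫⁻ x, ‖f x‖ₑ ^ 2 := by
  have h := eLpNorm_fourierInv_eq hf hf2
  have key : ∀ g : V → ℂ, ∫⁻ x, ‖g x‖ₑ ^ 2 = (eLpNorm g 2 volume) ^ 2 := fun g => by
    rw [eLpNorm_eq_lintegral_rpow_enorm_toReal (by norm_num) (by norm_num)]
    simp only [ENNReal.toReal_ofNat, ENNReal.rpow_ofNat]
    rw [← ENNReal.rpow_natCast, ← ENNReal.rpow_mul]; norm_num
  rw [key, key, h]

end Plancherel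

/-! ### Band-limited kernels and their Gaussian bias -/

section Kernel
open FourierTransform

/-- The standard Gaussian density on Euclidean space. -/
noncomputable def stdGaussianDensity {d : ℕ} (x : EuclideanSpace ℝ (Fin d)) : ℝ :=
  (√(2 * Real.pi))⁻¹ ^ d * Real.exp (-(1 / 2) * ‖x‖ ^ 2)

variable {d : ℕ}

local notation "E" => EuclideanSpace ℝ (Fin d)

theorem integrable_exp_neg_mul_sq_norm {b : ℝ} (hb : 0 < b) :
    Integrable (fun x : E => Real.exp (-b * ‖x‖ ^ 2)) := by
  have := GaussianFourier.integrable_cexp_neg_mul_sq_norm_add (V := E) (b := (b : ℂ))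
    (by simpa using hb) 0 0
  have h2 := this.norm
  refine h2.congr (Filter.Eventually.of_forall fun x => ?_)
  simp only [Complex.norm_exp]
  norm_num
  left
  norm_cast

theorem integrable_stdGaussianDensity : Integrable (stdGaussianDensity : E → ℝ) :=
  (integrable_exp_neg_mul_sq_norm (by norm_num)).const_mul _

theorem fourier_stdGaussianDensity (t : E) :
    𝓕 (fun x : E => (stdGaussianDensity x : ℂ)) t
      = (Real.exp (-(2 * Real.pi ^ 2) * ‖t‖ ^ 2) : ℂ) := by
  have h := fourier_gaussian_innerProductSpace (V := E) (b := (1 / 2 : ℂ)) (by norm_num) t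
  have h1 : (fun x : E => (stdGaussianDensity x : ℂ))
      = ((((√(2 * Real.pi))⁻¹ ^ d : ℝ)) : ℂ) • fun x : E => Complex.exp (-(1 / 2) * ‖x‖ ^ 2) := by
    ext x; simp [stdGaussianDensity]
  have h2 : ∀ (c : ℂ) (g : E → ℂ), 𝓕 (c • g) t = c • 𝓕 g t := fun c g => by
    simp only [Real.fourier_eq, Pi.smul_apply, smul_comm _ c, integral_smul]
  rw [h1, h2, h, smul_eq_mul, ← mul_assoc]
  have h3 : (Real.pi / (1 / 2) : ℂ) ^ (Module.finrank ℝ E / 2 : ℂ) = ((√(2 * Real.pi) ^ d : ℝ) : ℂ) := by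
    have : (Real.pi / (1 / 2) : ℂ) = ((2 * Real.pi : ℝ) : ℂ) := by push_cast; ring
    rw [this, finrank_euclideanSpace_fin, Real.sqrt_eq_rpow, ← Real.rpow_natCast, ← Real.rpow_mul (by positivity),
      Complex.ofReal_cpow (by positivity)]
    congr 1; push_cast; ring
  rw [h3, ← Complex.ofReal_mul, ← mul_pow, inv_mul_cancel₀ (by positivity)]
  simp only [one_pow, Complex.ofReal_one, one_mul]
  push_cast
  congr 1; ring

theorem fourierInv_exp_eq (x : E) :
    𝓕⁻ (fun t : E => (Real.exp (-(2 * Real.pi ^ 2) * ‖t‖ ^ 2) : ℂ)) x = stdGaussianDensity x := by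
  have h : 𝓕 (fun x : E => (stdGaussianDensity x : ℂ))
      = fun t => (Real.exp (-(2 * Real.pi ^ 2) * ‖t‖ ^ 2) : ℂ) := funext fourier_stdGaussianDensity
  have hc : Continuous (fun x : E => (stdGaussianDensity x : ℂ)) := by
    unfold stdGaussianDensity; fun_prop
  rw [← h, hc.fourierInv_fourier_eq integrable_stdGaussianDensity.ofReal]
  rw [h]
  exact (integrable_exp_neg_mul_sq_norm (by positivity)).ofReal

/-- Smoothing a kernel with frequency response `m` against the standard Gaussian density. -/
theorem integral_fourierInv_sub_mul_gaussian {m : E → ℂ} (hm : Integrable m) (x : E) :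
    ∫ y, 𝓕⁻ m (x - y) * (stdGaussianDensity y : ℂ)
      = 𝓕⁻ (fun t => m t * (Real.exp (-(2 * Real.pi ^ 2) * ‖t‖ ^ 2) : ℂ)) x := by
  -- Modulating `m` by the character of `x` turns `y ↦ 𝓕⁻ m (x - y)` into a forward transform, so
  -- the multiplication formula plays the role of the convolution theorem.
  set F : E → ℂ := fun t => Real.fourierChar (inner ℝ t x) • m t with hF
  have hFi : Integrable F := by
    refine (integrable_norm_iff ?_).1 ?_
    · have hc : Continuous (fun t : E => Real.fourierChar (inner ℝ t x)) := by fun_prop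
      exact hc.aestronglyMeasurable.smul hm.aestronglyMeasurable
    · simpa [hF] using hm.norm
  have h1 : ∀ y, 𝓕⁻ m (x - y) = 𝓕 F y := fun y => by
    rw [Real.fourierInv_eq, Real.fourier_eq]
    congr 1; ext t
    simp only [hF, smul_smul]
    rw [← AddChar.map_add_eq_mul, inner_sub_right]
    congr 2; ring
  have h2 : ∫ y, 𝓕 F y • (stdGaussianDensity y : ℂ)
      = ∫ t, F t • 𝓕 (fun y : E => (stdGaussianDensity y : ℂ)) t := by
    simpa using! VectorFourier.integral_fourierIntegral_smul_eq_flip (L := innerₗ E)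
      (μ := volume) (ν := volume) Real.continuous_fourierChar continuous_inner
      hFi integrable_stdGaussianDensity.ofReal
  simp only [h1]
  simp only [smul_eq_mul] at h2
  rw [h2, Real.fourierInv_eq]
  congr 1; ext t
  rw [fourier_stdGaussianDensity]
  simp only [hF, smul_mul_assoc]

theorem continuous_fourierInv {m : E → ℂ} (hm : Integrable m) : Continuous (𝓕⁻ m) := by
  have : 𝓕⁻ m = (𝓕 m) ∘ (fun x => -x) := by
    ext x; exact Real.fourierInv_eq_fourier_neg m x
  rw [this]
  exact (VectorFourier.fourierIntegral_continuous
    Real.continuous_fourierChar continuous_inner hm).comp continuous_neg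

theorem norm_fourierInv_le (m : E → ℂ) (x : E) : ‖𝓕⁻ m x‖ ≤ ∫ t, ‖m t‖ := by
  rw [Real.fourierInv_eq]
  refine (norm_integral_le_integral_norm _).trans_eq ?_
  simp

/-- `K` is the real part of the inverse transform of the indicator of the ball of radius `R`, so
Plancherel bounds its squared norm by the volume of the ball. The bias has as transform the part of
`exp(-2π²|t|²)` outside the ball. Taking real parts only decreases squares, so no proof that the
inverse transform is real is needed. -/
theorem exists_kernel_euclidean (d : ℕ) : ∃ C : ℝ, 0 < C ∧ ∀ R : ℝ, 0 < R →
    ∃ K : EuclideanSpace ℝ (Fin d) → ℝ, Continuous K ∧ (∃ B, ∀ x, |K x| ≤ B) ∧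
      ∫⁻ x, ENNReal.ofReal (K x ^ 2) ≤ ENNReal.ofReal (C * R ^ d) ∧
      ∫⁻ x, ENNReal.ofReal (((∫ y, K (x - y) * stdGaussianDensity y) - stdGaussianDensity x) ^ 2)
        ≤ ENNReal.ofReal (C * Real.exp (-(2 * Real.pi ^ 2 * R ^ 2))) := by
  set A : ℝ := ∫ t : EuclideanSpace ℝ (Fin d), Real.exp (-(2 * Real.pi ^ 2) * ‖t‖ ^ 2) with hA
  set v : ℝ := (volume (Metric.closedBall (0 : EuclideanSpace ℝ (Fin d)) 1)).toReal with hv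
  have hA0 : 0 ≤ A := integral_nonneg fun t => (Real.exp_pos _).le
  have hv0 : 0 ≤ v := ENNReal.toReal_nonneg
  have hint := integrable_exp_neg_mul_sq_norm (d := d) (b := 2 * Real.pi ^ 2) (by positivity)
  -- `v` serves the squared norm and `A` the bias; the 1 ensures positivity.
  refine ⟨A + v + 1, by positivity, fun R hR => ?_⟩
  set B := Metric.closedBall (0 : EuclideanSpace ℝ (Fin d)) R with hB
  set h : EuclideanSpace ℝ (Fin d) → ℂ :=
    fun t => (Real.exp (-(2 * Real.pi ^ 2) * ‖t‖ ^ 2) : ℂ) with hh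
  set m : EuclideanSpace ℝ (Fin d) → ℂ := B.indicator 1 with hm
  have hBm : MeasurableSet B := Metric.isClosed_closedBall.measurableSet
  have hBfin : volume B ≠ ∞ := measure_closedBall_lt_top.ne
  have hmi : Integrable m := (integrable_indicator_iff hBm).2 (integrableOn_const hBfin)
  have hm2 : MemLp m 2 := memLp_indicator_const 2 hBm 1 (Or.inr hBfin)
  have hhi : Integrable h := hint.ofReal
  set r : EuclideanSpace ℝ (Fin d) → ℂ := Bᶜ.indicator h with hr
  have hri : Integrable r := hhi.indicator hBm.compl
  have hh1 : ∀ t, ‖h t‖ ≤ 1 := fun t => by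
    simp only [hh, Complex.norm_real, Real.norm_eq_abs, Real.abs_exp, Real.exp_le_one_iff]
    have := sq_nonneg ‖t‖
    have := Real.pi_pos
    rw [neg_mul]; exact neg_nonpos.2 (by positivity)
  have hr1 : ∀ t, ‖r t‖ ≤ 1 := fun t => (norm_indicator_le_norm_self _ _).trans (hh1 t)
  have hr2 : MemLp r 2 := by
    refine (memLp_two_iff_integrable_sq_norm hri.aestronglyMeasurable).2 ?_
    refine hri.norm.mono (hri.aestronglyMeasurable.norm.pow 2)
      (Filter.Eventually.of_forall fun t => ?_)
    rw [norm_pow, norm_norm]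
    exact pow_le_of_le_one (norm_nonneg _) (hr1 t) two_ne_zero
  have hmul : (fun t => m t * h t) = h - r := by
    ext t
    by_cases ht : t ∈ B <;> simp [hm, hr, ht]
  have hbias : ∀ x, (∫ y, 𝓕⁻ m (x - y) * (stdGaussianDensity y : ℂ)) - stdGaussianDensity x
      = - 𝓕⁻ r x := fun x => by
    rw [integral_fourierInv_sub_mul_gaussian hmi, ← fourierInv_exp_eq]
    change 𝓕⁻ (fun t => m t * h t) x - 𝓕⁻ h x = _
    rw [hmul]
    simp only [Real.fourierInv_eq, Pi.sub_apply, smul_sub]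
    rw [integral_sub]
    · ring
    · exact (Real.fourierIntegral_convergent_iff (V := EuclideanSpace ℝ (Fin d)) (-x)).2 hhi |>.congr
        (by simp)
    · exact (Real.fourierIntegral_convergent_iff (V := EuclideanSpace ℝ (Fin d)) (-x)).2 hri |>.congr
        (by simp)
  have hKb : ∀ x, ‖𝓕⁻ m x‖ ≤ ∫ t, ‖m t‖ := norm_fourierInv_le m
  have hKc : Continuous (𝓕⁻ m) := continuous_fourierInv hmi
  have hsq : ∀ z : ℂ, ENNReal.ofReal (z.re ^ 2) ≤ ‖z‖ₑ ^ 2 := fun z => by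
    rw [← ofReal_norm, ← ENNReal.ofReal_pow (norm_nonneg _)]
    exact ENNReal.ofReal_le_ofReal (sq_le_sq' (by linarith [abs_le.1 (Complex.abs_re_le_norm z)])
      (Complex.re_le_norm z))
  refine ⟨fun x => (𝓕⁻ m x).re, Complex.continuous_re.comp hKc,
    ⟨_, fun x => (Complex.abs_re_le_norm _).trans (hKb x)⟩, ?_, ?_⟩
  · calc ∫⁻ x, ENNReal.ofReal ((𝓕⁻ m x).re ^ 2) ≤ ∫⁻ x, ‖𝓕⁻ m x‖ₑ ^ 2 :=
          lintegral_mono fun x => hsq _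
      _ = ∫⁻ x, ‖m x‖ₑ ^ 2 := lintegral_enorm_sq_fourierInv_eq hmi hm2
      _ = ∫⁻ x, B.indicator 1 x := by
          congr 1; ext x
          by_cases hx : x ∈ B <;> simp [hm, hx]
      _ = volume B := lintegral_indicator_one hBm
      _ = ENNReal.ofReal (R ^ d) * ENNReal.ofReal v := by
          rw [hB, Measure.addHaar_closedBall' _ _ hR.le, finrank_euclideanSpace_fin, hv,
            ENNReal.ofReal_toReal measure_closedBall_lt_top.ne]
      _ ≤ ENNReal.ofReal ((A + v + 1) * R ^ d) := by
          rw [← ENNReal.ofReal_mul (by positivity)]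
          refine ENNReal.ofReal_le_ofReal ?_
          rw [mul_comm]
          gcongr
          linarith
  -- The Gaussian is real, so smoothing against it commutes with taking real parts.
  · have hre : ∀ x, (∫ y, (𝓕⁻ m (x - y)).re * stdGaussianDensity y) - stdGaussianDensity x
        = (- 𝓕⁻ r x).re := fun x => by
      rw [← hbias x, Complex.sub_re, Complex.ofReal_re]
      congr 1
      have hI : Integrable (fun y => 𝓕⁻ m (x - y) * (stdGaussianDensity y : ℂ)) := by
        refine integrable_stdGaussianDensity.ofReal.bdd_mul
          (hKc.comp (continuous_const.sub continuous_id)).aestronglyMeasurable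
          (Filter.Eventually.of_forall fun y => hKb _)
      have := integral_re hI
      simpa using this
    simp only [hre]
    calc ∫⁻ x, ENNReal.ofReal ((- 𝓕⁻ r x).re ^ 2) ≤ ∫⁻ x, ‖𝓕⁻ r x‖ₑ ^ 2 :=
          lintegral_mono fun x => by simpa using hsq (- 𝓕⁻ r x)
      _ = ∫⁻ x, ‖r x‖ₑ ^ 2 := lintegral_enorm_sq_fourierInv_eq hri hr2
      _ ≤ ∫⁻ t, ENNReal.ofReal (Real.exp (-(2 * Real.pi ^ 2 * R ^ 2)) *
            Real.exp (-(2 * Real.pi ^ 2) * ‖t‖ ^ 2)) := by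
          refine lintegral_mono fun t => ?_
          by_cases ht : t ∈ B
          · simp [hr, ht]
          · have ht' : R < ‖t‖ := by simpa [hB] using ht
            rw [← ofReal_norm, ← ENNReal.ofReal_pow (norm_nonneg _)]
            refine ENNReal.ofReal_le_ofReal ?_
            simp only [hr, Set.indicator_of_mem (Set.mem_compl ht), hh, Complex.norm_real,
              Real.norm_eq_abs, Real.abs_exp]
            -- Of the two equal factors, one is bounded by its value at radius `R`; the other is
            -- kept and integrates to `A`.
            rw [sq, neg_mul]
            gcongr
      _ = ENNReal.ofReal (Real.exp (-(2 * Real.pi ^ 2 * R ^ 2)) * A) := by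
          rw [← ofReal_integral_eq_lintegral_ofReal (hint.const_mul _)
            (Filter.Eventually.of_forall fun t => by positivity), integral_const_mul]
      _ ≤ _ := by
          refine ENNReal.ofReal_le_ofReal ?_
          rw [mul_comm]
          gcongr
          linarith

theorem stdGaussianDensity_toLp (x : Fin d → ℝ) :
    stdGaussianDensity (WithLp.toLp 2 x) = ∏ i, gaussianPDFReal 0 1 (x i) := by
  simp only [stdGaussianDensity, gaussianPDFReal, EuclideanSpace.norm_sq_eq,
    Finset.prod_mul_distrib, Finset.prod_const, Finset.card_univ, Fintype.card_fin,
    ← Real.exp_sum, NNReal.coe_one, mul_one, sub_zero, Real.norm_eq_abs, sq_abs]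
  congr 2
  rw [Finset.mul_sum]
  exact Finset.sum_congr rfl fun i _ => by ring

/-- Band-limited kernels: squared norm of order `R ^ d`, exponentially small Gaussian bias. -/
theorem exists_kernel (d : ℕ) : ∃ C : ℝ, 0 < C ∧ ∀ R : ℝ, 0 < R →
    ∃ K : (Fin d → ℝ) → ℝ, Continuous K ∧ (∃ B, ∀ x, |K x| ≤ B) ∧
      ∫⁻ x, ENNReal.ofReal (K x ^ 2) ≤ ENNReal.ofReal (C * R ^ d) ∧
      ∫⁻ x, ENNReal.ofReal (((∫ y, K (x - y) * ∏ i, gaussianPDFReal 0 1 (y i))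
          - ∏ i, gaussianPDFReal 0 1 (x i)) ^ 2)
        ≤ ENNReal.ofReal (C * Real.exp (-(2 * Real.pi ^ 2 * R ^ 2))) := by
  obtain ⟨C, hC, h⟩ := exists_kernel_euclidean d
  refine ⟨C, hC, fun R hR => ?_⟩
  obtain ⟨K, hK, ⟨B, hB⟩, h1, h2⟩ := h R hR
  -- The Fourier argument needs the Euclidean inner product, while the statement lives on the plain
  -- product; the volume-preserving identification carries both integrals across.
  have hmp := PiLp.volume_preserving_toLp (Fin d)
  have hme : MeasurableEmbedding (@WithLp.toLp 2 (Fin d → ℝ)) :=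
    (MeasurableEquiv.toLp 2 (Fin d → ℝ)).measurableEmbedding
  refine ⟨fun x => K (WithLp.toLp 2 x), hK.comp (PiLp.continuous_toLp 2 _), ⟨B, fun x => hB _⟩,
    ?_, ?_⟩
  · rwa [hmp.lintegral_comp_emb hme (fun x => ENNReal.ofReal (K x ^ 2))]
  · have hx : ∀ x : Fin d → ℝ,
        ∫ y : Fin d → ℝ, K (WithLp.toLp 2 (x - y)) * stdGaussianDensity (WithLp.toLp 2 y)
        = ∫ y, K (WithLp.toLp 2 x - y) * stdGaussianDensity y := fun x => by
      rw [← hmp.integral_comp hme]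
      simp only [WithLp.toLp_sub]
    simp only [← stdGaussianDensity_toLp, hx]
    rwa [hmp.lintegral_comp_emb hme (fun x => ENNReal.ofReal
      (((∫ y, K (x - y) * stdGaussianDensity y) - stdGaussianDensity x) ^ 2))]

end Kernel

/-! ### Risk of the kernel estimator and the upper bound -/

section UpperBound

variable {d : ℕ}

/-- The standard Gaussian density on `Fin d → ℝ`. -/
noncomputable def gaussianProd (x : Fin d → ℝ) : ℝ := ∏ i, gaussianPDFReal 0 1 (x i)

theorem gaussianMixture_eq (G : Measure (Fin d → ℝ)) (x : Fin d → ℝ) :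
    gaussianMixture G x = ∫ u, gaussianProd (x - u) ∂G := rfl

theorem gaussianPDFReal_zero_one_le_one (x : ℝ) : gaussianPDFReal 0 1 x ≤ 1 := by
  rw [gaussianPDFReal]
  have h1 : (√(2 * Real.pi * (1 : NNReal)))⁻¹ ≤ 1 := by
    refine inv_le_one_of_one_le₀ (Real.one_le_sqrt.2 ?_)
    have := Real.pi_gt_three
    simp; linarith
  have h2 : Real.exp (-(x - 0) ^ 2 / (2 * (1 : NNReal))) ≤ 1 := by
    rw [Real.exp_le_one_iff]
    have := sq_nonneg x
    simp; linarith
  exact mul_le_one₀ h1 (Real.exp_pos _).le h2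

theorem gaussianProd_nonneg (x : Fin d → ℝ) : 0 ≤ gaussianProd x :=
  Finset.prod_nonneg fun _ _ => gaussianPDFReal_nonneg _ _ _

theorem gaussianProd_le_one (x : Fin d → ℝ) : gaussianProd x ≤ 1 :=
  Finset.prod_le_one (fun _ _ => gaussianPDFReal_nonneg _ _ _)
    fun _ _ => gaussianPDFReal_zero_one_le_one _

@[fun_prop]
theorem measurable_gaussianProd : Measurable (gaussianProd : (Fin d → ℝ) → ℝ) := by
  unfold gaussianProd
  exact Finset.measurable_prod _ fun i _ =>
    (measurable_gaussianPDFReal 0 1).comp (measurable_pi_apply i)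

theorem integrable_gaussianProd : Integrable (gaussianProd : (Fin d → ℝ) → ℝ) :=
  Integrable.fintype_prod fun _ => integrable_gaussianPDFReal 0 1

theorem integral_gaussianProd : ∫ x : Fin d → ℝ, gaussianProd x = 1 := by
  unfold gaussianProd
  rw [integral_fintype_prod_volume_eq_prod (fun _ => gaussianPDFReal 0 1)]
  simp [integral_gaussianPDFReal_eq_one]

theorem lintegral_gaussianProd : ∫⁻ x : Fin d → ℝ, ENNReal.ofReal (gaussianProd x) = 1 := by
  rw [← ofReal_integral_eq_lintegral_ofReal integrable_gaussianProd
    (Filter.Eventually.of_forall gaussianProd_nonneg), integral_gaussianProd, ENNReal.ofReal_one]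

theorem gaussianMixture_nonneg (G : Measure (Fin d → ℝ)) (x : Fin d → ℝ) :
    0 ≤ gaussianMixture G x :=
  integral_nonneg fun _ => gaussianProd_nonneg _

variable (G : Measure (Fin d → ℝ)) [IsProbabilityMeasure G]

theorem integrable_gaussianProd_sub (x : Fin d → ℝ) :
    Integrable (fun u => gaussianProd (x - u)) G :=
  Integrable.of_bound
    (Measurable.aestronglyMeasurable (by fun_prop)) 1
    (Filter.Eventually.of_forall fun u => by
      rw [Real.norm_of_nonneg (gaussianProd_nonneg _)]; exact gaussianProd_le_one _)

theorem measurable_gaussianMixture : Measurable (gaussianMixture G) := by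
  have : StronglyMeasurable (fun p : (Fin d → ℝ) × (Fin d → ℝ) => gaussianProd (p.1 - p.2)) := by
    apply Measurable.stronglyMeasurable; fun_prop
  exact this.integral_prod_right.measurable

theorem ofReal_gaussianMixture (x : Fin d → ℝ) : ENNReal.ofReal (gaussianMixture G x)
    = ∫⁻ u, ENNReal.ofReal (gaussianProd (x - u)) ∂G :=
  ofReal_integral_eq_lintegral_ofReal (integrable_gaussianProd_sub G x)
    (Filter.Eventually.of_forall fun _ => gaussianProd_nonneg _)

theorem lintegral_gaussianMixture : ∫⁻ x, ENNReal.ofReal (gaussianMixture G x) = 1 := by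
  simp only [ofReal_gaussianMixture]
  rw [lintegral_lintegral_swap (by fun_prop)]
  have : ∀ u : Fin d → ℝ, ∫⁻ x, ENNReal.ofReal (gaussianProd (x - u)) = 1 := fun u => by
    rw [lintegral_sub_right_eq_self (fun x => ENNReal.ofReal (gaussianProd x)) u,
      lintegral_gaussianProd]
  simp [this]

/-- The law with density `gaussianMixture G`. -/
noncomputable def mixtureLaw : Measure (Fin d → ℝ) :=
  volume.withDensity fun x => ENNReal.ofReal (gaussianMixture G x)

instance isProbabilityMeasure_mixtureLaw : IsProbabilityMeasure (mixtureLaw G) :=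
  ⟨by rw [mixtureLaw, withDensity_apply _ .univ, setLIntegral_univ, lintegral_gaussianMixture]⟩

/-- Integrals against a Gaussian mixture are mixtures of Gaussian integrals. -/
theorem integral_mixtureLaw {H : (Fin d → ℝ) → ℝ} (hH : Measurable H) {B : ℝ}
    (hB : ∀ x, |H x| ≤ B) :
    ∫ y, H y ∂(mixtureLaw G) = ∫ u, (∫ y, H y * gaussianProd (y - u)) ∂G := by
  have hfm := measurable_gaussianMixture G
  have hgi : Integrable (fun p : (Fin d → ℝ) × (Fin d → ℝ) => gaussianProd (p.1 - p.2))
      (volume.prod G) := by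
    rw [integrable_prod_iff' (Measurable.aestronglyMeasurable (by fun_prop))]
    refine ⟨Filter.Eventually.of_forall fun u => integrable_gaussianProd.comp_sub_right u, ?_⟩
    simp only [Real.norm_of_nonneg (gaussianProd_nonneg _)]
    have : ∀ u : Fin d → ℝ, ∫ x, gaussianProd (x - u) = 1 := fun u => by
      rw [integral_sub_right_eq_self gaussianProd u, integral_gaussianProd]
    simp [this]
  have hHi : Integrable (fun p : (Fin d → ℝ) × (Fin d → ℝ) => H p.1 * gaussianProd (p.1 - p.2))
      (volume.prod G) :=
    hgi.bdd_mul (c := B) (hH.comp measurable_fst).aestronglyMeasurable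
      (Filter.Eventually.of_forall fun p => hB _)
  rw [mixtureLaw, integral_withDensity_eq_integral_toReal_smul (by fun_prop)
    (Filter.Eventually.of_forall fun _ => ENNReal.ofReal_lt_top),
    ← integral_integral_swap (f := fun y u => H y * gaussianProd (y - u)) hHi]
  refine integral_congr_ae (Filter.Eventually.of_forall fun y => ?_)
  simp only [ENNReal.toReal_ofReal (gaussianMixture_nonneg G y), smul_eq_mul]
  rw [integral_const_mul, mul_comm, gaussianMixture_eq]

/-- Jensen's inequality for the square, read off from the nonnegativity of the variance. -/
theorem sq_integral_le_integral_sq {α : Type*} [MeasurableSpace α] {μ : Measure α}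
    [IsProbabilityMeasure μ] {D : α → ℝ} (hD : MemLp D 2 μ) :
    (∫ u, D u ∂μ) ^ 2 ≤ ∫ u, D u ^ 2 ∂μ := by
  have h := variance_nonneg D μ
  rw [variance_eq_sub hD] at h
  simpa using h

/-- The kernel density estimator. -/
noncomputable def kernelEstimator (n : ℕ) (K : (Fin d → ℝ) → ℝ) (X : Fin n → Fin d → ℝ)
    (x : Fin d → ℝ) : ℝ :=
  ∑ i, (n : ℝ)⁻¹ * K (x - X i)

theorem isEstimator_kernelEstimator (n : ℕ) {K : (Fin d → ℝ) → ℝ} (hK : Measurable K) :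
    IsEstimator (kernelEstimator n K) := by
  unfold IsEstimator Function.uncurry kernelEstimator
  fun_prop

/-- Bias-variance bound at a point. -/
theorem lintegral_kernelEstimator_le {n : ℕ} (hn : 0 < n) {K : (Fin d → ℝ) → ℝ}
    (hK : Measurable K) {B : ℝ} (hB : ∀ x, |K x| ≤ B) (μ : Measure (Fin d → ℝ))
    [IsProbabilityMeasure μ] (x : Fin d → ℝ) (c : ℝ) :
    ∫⁻ X, ENNReal.ofReal ((kernelEstimator n K X x - c) ^ 2) ∂(Measure.pi fun _ : Fin n => μ)
      ≤ ENNReal.ofReal ((n : ℝ)⁻¹) * (∫⁻ y, ENNReal.ofReal (K (x - y) ^ 2) ∂μ)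
        + ENNReal.ofReal (((∫ y, K (x - y) ∂μ) - c) ^ 2) := by
  have hn0 : (0 : ℝ) < n := by exact_mod_cast hn
  set P := Measure.pi fun _ : Fin n => μ with hP
  set Y : (Fin d → ℝ) → ℝ := fun y => (n : ℝ)⁻¹ * K (x - y) with hY
  have hKx : MemLp (fun y => K (x - y)) 2 μ :=
    MemLp.of_bound (Measurable.aestronglyMeasurable (by fun_prop)) B
      (Filter.Eventually.of_forall fun y => hB _)
  have hYL : MemLp Y 2 μ := hKx.const_mul _
  set S : (Fin n → Fin d → ℝ) → ℝ := ∑ i, fun X => Y (X i) with hS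
  have hSeq : ∀ X, kernelEstimator n K X x = S X := fun X => by
    simp [hS, hY, kernelEstimator]
  have hYe : ∀ i : Fin n, MemLp (fun X : Fin n → Fin d → ℝ => Y (X i)) 2 P := fun i =>
    hYL.comp_measurePreserving (measurePreserving_eval (fun _ : Fin n => μ) i)
  have hSL : MemLp S 2 P := memLp_finsetSum' _ fun i _ => hYe i
  have hmean : ∫ X, S X ∂P = ∫ y, K (x - y) ∂μ := by
    simp only [hS, Finset.sum_apply]
    rw [integral_finsetSum _ fun i _ => (hYe i).integrable (by norm_num)]
    have : ∀ i : Fin n, ∫ X, Y (X i) ∂P = (n : ℝ)⁻¹ * ∫ y, K (x - y) ∂μ := fun i => by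
      rw [hP, integral_comp_eval (μ := fun _ : Fin n => μ) hYL.aestronglyMeasurable,
        integral_const_mul]
    simp [this, hn0.ne']
  have hvar : Var[S; P] ≤ (n : ℝ)⁻¹ * ∫ y, K (x - y) ^ 2 ∂μ := by
    rw [hS, hP, variance_sum_pi fun _ => hYL]
    simp only [hY, variance_const_mul, Finset.sum_const, Finset.card_univ, Fintype.card_fin,
      nsmul_eq_mul]
    have := variance_le_expectation_sq (μ := μ) hKx.aestronglyMeasurable
    simp only [Pi.pow_apply] at this
    calc _ = (n : ℝ)⁻¹ * Var[fun y => K (x - y); μ] := by field_simp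
      _ ≤ _ := by gcongr
  have hSc : MemLp (fun X => S X - c) 2 P := hSL.sub (memLp_const c)
  have hsq : ∫ X, (S X - c) ^ 2 ∂P = Var[S; P] + ((∫ y, K (x - y) ∂μ) - c) ^ 2 := by
    have h1 := variance_eq_sub hSc
    rw [variance_sub_const hSL.aestronglyMeasurable,
      integral_sub (hSL.integrable (by norm_num)) (integrable_const _), hmean] at h1
    simp only [Pi.pow_apply, integral_const, probReal_univ, one_smul] at h1
    linarith
  simp only [hSeq]
  rw [← ofReal_integral_eq_lintegral_ofReal hSc.integrable_sq
      (Filter.Eventually.of_forall fun X => sq_nonneg _),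
    ← ofReal_integral_eq_lintegral_ofReal hKx.integrable_sq
      (Filter.Eventually.of_forall fun X => sq_nonneg _), ← ENNReal.ofReal_mul (by positivity),
    ← ENNReal.ofReal_add (mul_nonneg (by positivity) (integral_nonneg fun _ => sq_nonneg _))
      (sq_nonneg _), hsq]
  exact ENNReal.ofReal_le_ofReal (by linarith)

/-- The bias at `x` is the `G`-average of translates `D (x - u)` of the bias `D` for a single
Gaussian. Jensen moves the square inside the average, and translation invariance of Lebesgue measure
removes `u`. -/
theorem lintegral_bias_le {K : (Fin d → ℝ) → ℝ}
    (hK : Measurable K) {B : ℝ} (hB : ∀ x, |K x| ≤ B) :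
    ∫⁻ x, ENNReal.ofReal (((∫ y, K (x - y) ∂(mixtureLaw G)) - gaussianMixture G x) ^ 2)
      ≤ ∫⁻ x, ENNReal.ofReal (((∫ y, K (x - y) * gaussianProd y) - gaussianProd x) ^ 2) := by
  set κ : (Fin d → ℝ) → ℝ := fun z => ∫ y, K (z - y) * gaussianProd y with hκ
  have hκm : Measurable κ := by
    have : StronglyMeasurable
        (fun p : (Fin d → ℝ) × (Fin d → ℝ) => K (p.1 - p.2) * gaussianProd p.2) := by
      apply Measurable.stronglyMeasurable; fun_prop
    exact this.integral_prod_right.measurable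
  have hκb : ∀ z, |κ z| ≤ B := fun z => by
    calc |κ z| ≤ ∫ y : Fin d → ℝ, B * gaussianProd y := by
          change ‖∫ y, K (z - y) * gaussianProd y‖ ≤ _
          refine norm_integral_le_of_norm_le (integrable_gaussianProd.const_mul B)
            (Filter.Eventually.of_forall fun y => ?_)
          rw [norm_mul, Real.norm_of_nonneg (gaussianProd_nonneg y)]
          exact mul_le_mul_of_nonneg_right (hB _) (gaussianProd_nonneg y)
      _ = B := by rw [integral_const_mul, integral_gaussianProd, mul_one]
  have hκi : ∀ x, Integrable (fun u => κ (x - u)) G := fun x =>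
    Integrable.of_bound (Measurable.aestronglyMeasurable (by fun_prop)) B
      (Filter.Eventually.of_forall fun u => hκb _)
  set D : (Fin d → ℝ) → ℝ := fun z => κ z - gaussianProd z with hD
  have hDm : Measurable D := hκm.sub measurable_gaussianProd
  have hDb : ∀ z, |D z| ≤ B + 1 := fun z => by
    refine (abs_sub _ _).trans (add_le_add (hκb z) ?_)
    rw [abs_of_nonneg (gaussianProd_nonneg z)]
    exact gaussianProd_le_one z
  have hmean : ∀ x, (∫ y, K (x - y) ∂(mixtureLaw G)) - gaussianMixture G x
      = ∫ u, D (x - u) ∂G := fun x => by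
    rw [integral_mixtureLaw G (H := fun y => K (x - y)) (by fun_prop) (fun y => hB _),
      gaussianMixture_eq, ← integral_sub _ (integrable_gaussianProd_sub G x)]
    · refine integral_congr_ae (Filter.Eventually.of_forall fun u => ?_)
      simp only [hD, hκ]
      rw [← integral_add_right_eq_self (fun y => K (x - y) * gaussianProd (y - u)) u]
      simp only [add_sub_cancel_right, sub_add_eq_sub_sub_swap]
    · refine (hκi x).congr (Filter.Eventually.of_forall fun u => ?_)
      simp only [hκ]
      rw [← integral_add_right_eq_self (fun y => K (x - y) * gaussianProd (y - u)) u]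
      simp only [add_sub_cancel_right, sub_add_eq_sub_sub_swap]
  have hDL : ∀ x, MemLp (fun u => D (x - u)) 2 G := fun x =>
    MemLp.of_bound (Measurable.aestronglyMeasurable (by fun_prop)) (B + 1)
      (Filter.Eventually.of_forall fun u => hDb _)
  simp only [hmean]
  calc _ ≤ ∫⁻ x, ∫⁻ u, ENNReal.ofReal (D (x - u) ^ 2) ∂G := by
        refine lintegral_mono fun x => ?_
        rw [← ofReal_integral_eq_lintegral_ofReal (hDL x).integrable_sq
          (Filter.Eventually.of_forall fun X => sq_nonneg _)]
        exact ENNReal.ofReal_le_ofReal (sq_integral_le_integral_sq (hDL x))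
    _ = ∫⁻ u, (∫⁻ x, ENNReal.ofReal (D (x - u) ^ 2)) ∂G :=
        lintegral_lintegral_swap (Measurable.aemeasurable (by fun_prop))
    _ = _ := by
        have : ∀ u : Fin d → ℝ, ∫⁻ x, ENNReal.ofReal (D (x - u) ^ 2)
            = ∫⁻ x, ENNReal.ofReal (D x ^ 2) := fun y =>
          lintegral_sub_right_eq_self (fun x => ENNReal.ofReal (D x ^ 2)) y
        simp only [this, lintegral_const, measure_univ, mul_one]
        rfl

/-- By Tonelli the pointwise bias-variance bound is integrated over `x`; the variance term loses its
dependence on the sampling law by translation invariance. The right-hand side is free of `G`, as a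
minimax bound requires. -/
theorem kernelEstimator_risk_le {n : ℕ} (hn : 0 < n) {K : (Fin d → ℝ) → ℝ}
    (hK : Measurable K) {B : ℝ} (hB : ∀ x, |K x| ≤ B) :
    ∫⁻ X, sqL2Loss (kernelEstimator n K X) (gaussianMixture G) ∂(sampleLaw n (gaussianMixture G))
      ≤ ENNReal.ofReal ((n : ℝ)⁻¹) * (∫⁻ x, ENNReal.ofReal (K x ^ 2))
        + ∫⁻ x, ENNReal.ofReal (((∫ y, K (x - y) * gaussianProd y) - gaussianProd x) ^ 2) := by
  have hm : Measurable (gaussianMixture G) := measurable_gaussianMixture G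
  have hest : Measurable (Function.uncurry (kernelEstimator n K)) := isEstimator_kernelEstimator n hK
  have hmeas : Measurable (fun p : (Fin n → Fin d → ℝ) × (Fin d → ℝ) =>
      ENNReal.ofReal ((kernelEstimator n K p.1 p.2 - gaussianMixture G p.2) ^ 2)) :=
    (((hest.sub (hm.comp measurable_snd))).pow_const 2).ennreal_ofReal
  change ∫⁻ X, (∫⁻ x, ENNReal.ofReal ((kernelEstimator n K X x - gaussianMixture G x) ^ 2))
    ∂(Measure.pi fun _ : Fin n => mixtureLaw G) ≤ _
  rw [lintegral_lintegral_swap hmeas.aemeasurable]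
  have hKm : Measurable (fun p : (Fin d → ℝ) × (Fin d → ℝ) =>
      ENNReal.ofReal (K (p.1 - p.2) ^ 2)) := by fun_prop
  calc _ ≤ ∫⁻ x, (ENNReal.ofReal ((n : ℝ)⁻¹) * (∫⁻ y, ENNReal.ofReal (K (x - y) ^ 2) ∂(mixtureLaw G))
        + ENNReal.ofReal (((∫ y, K (x - y) ∂(mixtureLaw G)) - gaussianMixture G x) ^ 2)) :=
        lintegral_mono fun x => lintegral_kernelEstimator_le hn hK hB _ x _
    _ = ENNReal.ofReal ((n : ℝ)⁻¹) * (∫⁻ x, ∫⁻ y, ENNReal.ofReal (K (x - y) ^ 2) ∂(mixtureLaw G))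
        + ∫⁻ x, ENNReal.ofReal (((∫ y, K (x - y) ∂(mixtureLaw G)) - gaussianMixture G x) ^ 2) := by
        rw [lintegral_add_left (hKm.lintegral_prod_right'.const_mul _),
          lintegral_const_mul _ hKm.lintegral_prod_right']
    _ ≤ _ := by
        refine add_le_add (le_of_eq ?_) (lintegral_bias_le G hK hB)
        rw [lintegral_lintegral_swap hKm.aemeasurable]
        have : ∀ y : Fin d → ℝ, ∫⁻ x, ENNReal.ofReal (K (x - y) ^ 2)
            = ∫⁻ x, ENNReal.ofReal (K x ^ 2) := fun y =>
          lintegral_sub_right_eq_self (fun x => ENNReal.ofReal (K x ^ 2)) y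
        simp [this]

end UpperBound

/-- Upper bound on the minimax risk over Gaussian mixtures. -/
theorem exists_minimaxRisk_le (d : ℕ) : ∃ C : ℝ, 0 < C ∧ ∀ n : ℕ, 2 ≤ n →
    densityMinimaxRisk n (gaussianMixtureClass d) sqL2Loss
      ≤ ENNReal.ofReal (C * (Real.log n ^ ((d : ℝ) / 2) / n)) := by
  obtain ⟨C, hC, h⟩ := exists_kernel d
  have hl2 : 0 < Real.log 2 := Real.log_pos (by norm_num)
  -- The second summand absorbs the bias `C / n` into the rate, since `log n ≥ log 2`.
  refine ⟨C * (1 + (Real.log 2 ^ ((d : ℝ) / 2))⁻¹), by positivity, fun n hn => ?_⟩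
  have hn0 : (0 : ℝ) < n := by positivity
  have hln : 0 < Real.log n := Real.log_pos (by exact_mod_cast hn)
  have hpi := Real.pi_gt_three
  -- The cutoff solves `exp(-2π²R²) = 1/n`.
  obtain ⟨K, hK, ⟨B, hB⟩, h1, h2⟩ := h (√(Real.log n / (2 * Real.pi ^ 2))) (by positivity)
  refine (iInf₂_le (kernelEstimator n K) (isEstimator_kernelEstimator n hK.measurable)).trans ?_
  refine iSup₂_le ?_
  rintro f ⟨G, hG, rfl⟩
  refine (kernelEstimator_risk_le G (by omega) hK.measurable hB).trans ?_
  refine (add_le_add (mul_le_mul_right h1 _) h2).trans ?_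
  rw [← ENNReal.ofReal_mul (by positivity), ← ENNReal.ofReal_add (by positivity) (by positivity)]
  refine ENNReal.ofReal_le_ofReal ?_
  have e1 : √(Real.log n / (2 * Real.pi ^ 2)) ^ d ≤ Real.log n ^ ((d : ℝ) / 2) := by
    have : Real.log n ^ ((d : ℝ) / 2) = √(Real.log n) ^ d := by
      rw [Real.sqrt_eq_rpow, ← Real.rpow_natCast, ← Real.rpow_mul hln.le]; congr 1; ring
    rw [this]
    gcongr
    exact div_le_self hln.le (by nlinarith)
  have e2 : Real.exp (-(2 * Real.pi ^ 2 * √(Real.log n / (2 * Real.pi ^ 2)) ^ 2)) = (n : ℝ)⁻¹ := by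
    rw [Real.sq_sqrt (by positivity), mul_div_cancel₀ _ (by positivity), Real.exp_neg,
      Real.exp_log hn0]
  have e3 : 1 ≤ (Real.log 2 ^ ((d : ℝ) / 2))⁻¹ * Real.log n ^ ((d : ℝ) / 2) := by
    rw [inv_mul_eq_div, one_le_div (by positivity)]
    gcongr
    exact_mod_cast hn
  rw [e2]
  calc _ ≤ (n : ℝ)⁻¹ * (C * Real.log n ^ ((d : ℝ) / 2)) + C * (n : ℝ)⁻¹ *
        ((Real.log 2 ^ ((d : ℝ) / 2))⁻¹ * Real.log n ^ ((d : ℝ) / 2)) := by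
        refine add_le_add ?_ ?_
        · gcongr
        · exact le_mul_of_one_le_right (by positivity) e3
    _ = _ := by ring

/-! ### Product densities, a two-point bound and Bessel's inequality -/

section Tools

/-- A product of measures with real densities has the product density. -/
theorem pi_withDensity_ofReal {ι α : Type*} [Fintype ι] [MeasurableSpace α] (μ : Measure α)
    [SigmaFinite μ] {g : α → ℝ} (hi : Integrable g μ) (h0 : ∀ x, 0 ≤ g x) :
    Measure.pi (fun _ : ι => μ.withDensity fun x => ENNReal.ofReal (g x))
      = (Measure.pi fun _ : ι => μ).withDensity fun x => ENNReal.ofReal (∏ i, g (x i)) := by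
  have hfin : IsFiniteMeasure (μ.withDensity fun x => ENNReal.ofReal (g x)) :=
    isFiniteMeasure_withDensity_ofReal hi.2
  refine Measure.pi_eq fun s hs => ?_
  rw [withDensity_apply _ (.univ_pi hs), ← lintegral_indicator (.univ_pi hs)]
  have hind : ∀ i, Integrable ((s i).indicator g) μ := fun i => hi.indicator (hs i)
  have h1 : ∀ x : ι → α, (Set.univ.pi s).indicator (fun x => ENNReal.ofReal (∏ i, g (x i))) x
      = ENNReal.ofReal (∏ i, (s i).indicator g (x i)) := fun x => by
    by_cases hx : x ∈ Set.univ.pi s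
    · rw [Set.indicator_of_mem hx]
      congr 1
      exact Finset.prod_congr rfl fun i _ => by rw [Set.indicator_of_mem (hx i trivial)]
    · rw [Set.indicator_of_notMem hx]
      simp only [Set.mem_pi, Set.mem_univ, true_implies, not_forall] at hx
      obtain ⟨i, hi⟩ := hx
      rw [Finset.prod_eq_zero (Finset.mem_univ i) (Set.indicator_of_notMem hi g),
        ENNReal.ofReal_zero]
  have hnn : ∀ i x, 0 ≤ (s i).indicator g x := fun i x =>
    Set.indicator_nonneg (fun x _ => h0 x) x
  simp only [h1]
  rw [← ofReal_integral_eq_lintegral_ofReal (Integrable.fintype_prod_dep hind)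
    (Filter.Eventually.of_forall fun x => Finset.prod_nonneg fun i _ => hnn i _),
    integral_fintype_prod_eq_prod, ENNReal.ofReal_prod_of_nonneg
      fun i _ => integral_nonneg (hnn i)]
  refine Finset.prod_congr rfl fun i _ => ?_
  rw [withDensity_apply _ (hs i), ← ofReal_integral_eq_lintegral_ofReal hi.integrableOn
    (Filter.Eventually.of_forall h0), integral_indicator (hs i)]

/-- Here `f` may change sign: the right side is the integral of its positive part. The minorant in
the two-point bound needs this. -/
theorem ofReal_integral_le_lintegral_ofReal {α : Type*} [MeasurableSpace α] {μ : Measure α}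
    {f : α → ℝ} (hf : Integrable f μ) :
    ENNReal.ofReal (∫ x, f x ∂μ) ≤ ∫⁻ x, ENNReal.ofReal (f x) ∂μ := by
  have h := ofReal_integral_eq_lintegral_ofReal hf.pos_part
    (Filter.Eventually.of_forall fun x => le_max_right _ _)
  have h2 : ∀ x, ENNReal.ofReal (max (f x) 0) = ENNReal.ofReal (f x) := fun x => by
    simp [ENNReal.ofReal_max]
  simp only [h2] at h
  rw [← h]
  exact ENNReal.ofReal_le_ofReal
    (integral_mono hf hf.pos_part fun x => le_max_left _ _)

/-- Two-point lower bound: no statistic estimates both `0` and `b` well under two laws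
whose densities `w₀`, `w₁` are close in chi-square divergence. -/
theorem two_point_lower_bound {Ω : Type*} [MeasurableSpace Ω] {Q : Measure Ω}
    {w₀ w₁ T : Ω → ℝ} (b : ℝ) (hw₀ : Measurable w₀) (hT : Measurable T)
    (h₀ : ∀ ω, 0 < w₀ ω) (h₁ : ∀ ω, 0 ≤ w₁ ω) (hi₁ : Integrable w₁ Q)
    (hi₂ : Integrable (fun ω => w₁ ω ^ 2 / w₀ ω) Q) (hone : ∫ ω, w₁ ω ∂Q = 1)
    (hchi : ∫ ω, w₁ ω ^ 2 / w₀ ω ∂Q ≤ 3) :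
    ENNReal.ofReal (b ^ 2 / 4) ≤ ∫⁻ ω, ENNReal.ofReal (w₀ ω) * ENNReal.ofReal (T ω ^ 2) ∂Q
      + ∫⁻ ω, ENNReal.ofReal (w₁ ω) * ENNReal.ofReal ((T ω - b) ^ 2) ∂Q := by
  -- With `r = w₁ / w₀`, minimising `t² + r(t - b)²` over `t` gives `b² r/(1 + r)`. The quadratic
  -- `(7r - r²)/16` lies below `r/(1 + r)` and touches it at `0` and `3`, the difference being `r(r
  -- - 3)²/(16(1 + r))`. Its integral against `w₀` is at least `7/16 - 3/16 = 1/4`.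
  have hpt : ∀ ω, b ^ 2 * (7 / 16 * w₁ ω - 1 / 16 * (w₁ ω ^ 2 / w₀ ω))
      ≤ w₀ ω * T ω ^ 2 + w₁ ω * (T ω - b) ^ 2 := fun ω => by
    have ha := h₀ ω
    have hb := h₁ ω
    have hr : 0 ≤ w₁ ω / w₀ ω := by positivity
    set r := w₁ ω / w₀ ω with hrdef
    set t := T ω
    have e1 : w₁ ω = w₀ ω * r := by rw [hrdef]; field_simp
    have e2 : w₁ ω ^ 2 / w₀ ω = w₀ ω * r ^ 2 := by rw [hrdef]; field_simp
    rw [e2, e1]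
    have key : b ^ 2 * (7 / 16 * r - 1 / 16 * r ^ 2) ≤ t ^ 2 + r * (t - b) ^ 2 := by
      have k1 : 0 ≤ ((1 + r) * t - r * b) ^ 2 := sq_nonneg _
      have k2 : 0 ≤ r * (b * (r - 3)) ^ 2 := by positivity
      have : 0 ≤ (1 + r) * (t ^ 2 + r * (t - b) ^ 2 - b ^ 2 * (7 / 16 * r - 1 / 16 * r ^ 2)) := by
        nlinarith
      have := nonneg_of_mul_nonneg_right this (by linarith)
      linarith
    nlinarith [mul_le_mul_of_nonneg_left key ha.le]
  have hint : Integrable (fun ω => b ^ 2 * (7 / 16 * w₁ ω - 1 / 16 * (w₁ ω ^ 2 / w₀ ω))) Q :=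
    ((hi₁.const_mul _).sub (hi₂.const_mul _)).const_mul _
  calc ENNReal.ofReal (b ^ 2 / 4)
      ≤ ENNReal.ofReal (∫ ω, b ^ 2 * (7 / 16 * w₁ ω - 1 / 16 * (w₁ ω ^ 2 / w₀ ω)) ∂Q) := by
        refine ENNReal.ofReal_le_ofReal ?_
        rw [integral_const_mul, integral_sub (hi₁.const_mul _) (hi₂.const_mul _),
          integral_const_mul, integral_const_mul, hone]
        nlinarith [sq_nonneg b]
    _ ≤ ∫⁻ ω, ENNReal.ofReal (b ^ 2 * (7 / 16 * w₁ ω - 1 / 16 * (w₁ ω ^ 2 / w₀ ω))) ∂Q :=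
        ofReal_integral_le_lintegral_ofReal hint
    _ ≤ ∫⁻ ω, (ENNReal.ofReal (w₀ ω) * ENNReal.ofReal (T ω ^ 2)
          + ENNReal.ofReal (w₁ ω) * ENNReal.ofReal ((T ω - b) ^ 2)) ∂Q := by
        refine lintegral_mono fun ω => ?_
        have := h₀ ω
        have := h₁ ω
        rw [← ENNReal.ofReal_mul (by positivity), ← ENNReal.ofReal_mul (by positivity),
          ← ENNReal.ofReal_add (by positivity) (by positivity)]
        exact ENNReal.ofReal_le_ofReal (hpt ω)
    _ = _ := lintegral_add_left (by fun_prop) _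

/-- Bessel's inequality for a finite orthogonal family of functions of equal norm. -/
theorem sum_sq_integral_mul_le {α ι : Type*} [MeasurableSpace α] {ν : Measure α} [Fintype ι]
    [DecidableEq ι] {e : ι → α → ℝ} {κ : ℝ} (hκ : 0 < κ) (he : ∀ j, MemLp (e j) 2 ν)
    (horth : ∀ j k, ∫ x, e j x * e k x ∂ν = if j = k then κ else 0)
    {h : α → ℝ} (hh : MemLp h 2 ν) :
    ∑ j, (∫ x, h x * e j x ∂ν) ^ 2 ≤ κ * ∫ x, h x ^ 2 ∂ν := by
  set c : ι → ℝ := fun j => ∫ x, h x * e j x ∂ν with hc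
  have hhe : ∀ j, Integrable (fun x => h x * e j x) ν := fun j => hh.integrable_mul (he j)
  have hee : ∀ j k, Integrable (fun x => e j x * e k x) ν := fun j k => (he j).integrable_mul (he k)
  have h1 : Integrable (fun x => ∑ j, c j * (h x * e j x)) ν :=
    integrable_finsetSum _ fun j _ => (hhe j).const_mul _
  have h2 : Integrable (fun x => ∑ j, ∑ k, c j * c k * (e j x * e k x)) ν :=
    integrable_finsetSum _ fun j _ => integrable_finsetSum _ fun k _ => (hee j k).const_mul _
  have i1 : ∫ x, ∑ j, c j * (h x * e j x) ∂ν = ∑ j, c j ^ 2 := by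
    rw [integral_finsetSum _ fun j _ => (hhe j).const_mul _]
    refine Finset.sum_congr rfl fun j _ => ?_
    rw [integral_const_mul, sq]
  have i2 : ∫ x, ∑ j, ∑ k, c j * c k * (e j x * e k x) ∂ν = κ * ∑ j, c j ^ 2 := by
    rw [integral_finsetSum _ fun j _ => integrable_finsetSum _ fun k _ => (hee j k).const_mul _,
      Finset.mul_sum]
    refine Finset.sum_congr rfl fun j _ => ?_
    rw [integral_finsetSum _ fun k _ => (hee j k).const_mul _]
    simp only [integral_const_mul, horth]
    simp [sq, mul_comm]
  have hsq : ∀ x, (κ * h x - ∑ j, c j * e j x) ^ 2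
      = κ ^ 2 * h x ^ 2 - 2 * κ * ∑ j, c j * (h x * e j x)
        + ∑ j, ∑ k, c j * c k * (e j x * e k x) := fun x => by
    have a1 : ∑ j, c j * (h x * e j x) = h x * ∑ j, c j * e j x := by
      rw [Finset.mul_sum]; exact Finset.sum_congr rfl fun j _ => by ring
    have a2 : ∑ j, ∑ k, c j * c k * (e j x * e k x) = (∑ j, c j * e j x) ^ 2 := by
      rw [sq, Finset.sum_mul_sum]
      exact Finset.sum_congr rfl fun j _ => Finset.sum_congr rfl fun k _ => by ring
    rw [a1, a2]; ring
  -- By orthogonality this integral is `κ² ∫ h² - κ ∑ c_j²`; dividing by `κ` gives the claim.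
  have hnn : 0 ≤ ∫ x, (κ * h x - ∑ j, c j * e j x) ^ 2 ∂ν := integral_nonneg fun x => sq_nonneg _
  simp only [hsq] at hnn
  have h3 : Integrable (fun x => κ ^ 2 * h x ^ 2 - 2 * κ * ∑ j, c j * (h x * e j x)) ν :=
    (hh.integrable_sq.const_mul _).sub (h1.const_mul _)
  rw [integral_add h3 h2, integral_sub (hh.integrable_sq.const_mul _) (h1.const_mul _), integral_const_mul,
    integral_const_mul, i1, i2] at hnn
  have : 0 ≤ κ * (κ * (∫ x, h x ^ 2 ∂ν) - ∑ j, c j ^ 2) := by linarith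
  have := nonneg_of_mul_nonneg_right this hκ
  linarith

end Tools

/-! ### Sines under Gaussian smoothing and their orthogonality -/

section SineIntegrals

/-- This is the imaginary part of the Gaussian characteristic function. -/
theorem integral_sin_gaussianReal (μ : ℝ) (v : NNReal) (t : ℝ) :
    ∫ u, Real.sin (t * u) ∂(gaussianReal μ v) = Real.exp (-(v * t ^ 2 / 2)) * Real.sin (t * μ) := by
  have h := charFun_gaussianReal (μ := μ) (v := v) t
  rw [charFun_apply_real] at h
  have hi : Integrable (fun x : ℝ => Complex.exp (t * x * Complex.I)) (gaussianReal μ v) := by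
    refine Integrable.of_bound (by fun_prop) 1 (Filter.Eventually.of_forall fun x => ?_)
    rw [← Complex.ofReal_mul, Complex.norm_exp_ofReal_mul_I]
  have him := integral_im hi
  simp only [h, RCLike.im_to_complex] at him
  have e1 : ∀ x : ℝ, (Complex.exp (t * x * Complex.I)).im = Real.sin (t * x) := fun x => by
    rw [← Complex.ofReal_mul, Complex.exp_ofReal_mul_I_im]
  simp only [e1] at him
  rw [him]
  have : (t * μ * Complex.I - v * t ^ 2 / 2 : ℂ)
      = ((-(v * t ^ 2 / 2) : ℝ) : ℂ) + ((t * μ : ℝ) : ℂ) * Complex.I := by push_cast; ring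
  rw [this, Complex.exp_add, ← Complex.ofReal_exp, Complex.im_ofReal_mul,
    Complex.exp_ofReal_mul_I_im]

/-- Completing the square in `u`: a standard Gaussian location observed with standard Gaussian noise
has marginal `N(0, 2)` and posterior `N(x/2, 1/2)`. -/
theorem gaussianPDFReal_mul_gaussianPDFReal (x u : ℝ) :
    gaussianPDFReal 0 1 (x - u) * gaussianPDFReal 0 1 u
      = gaussianPDFReal 0 2 x * gaussianPDFReal (x / 2) (1 / 2) u := by
  have h2 : ((2 : NNReal) : ℝ) = 2 := rfl
  have hh : ((1 / 2 : NNReal) : ℝ) = 1 / 2 := by push_cast; rfl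
  simp only [gaussianPDFReal, NNReal.coe_one, h2, hh, mul_one, sub_zero]
  rw [mul_mul_mul_comm, mul_mul_mul_comm (√(2 * Real.pi * 2))⁻¹, ← Real.exp_add, ← Real.exp_add,
    ← mul_inv, ← mul_inv, ← Real.sqrt_mul (by positivity), ← Real.sqrt_mul (by positivity)]
  have e1 : 2 * Real.pi * (2 * Real.pi) = 2 * Real.pi * 2 * (2 * Real.pi * (1 / 2)) := by ring
  have e2 : -(x - u) ^ 2 / 2 + -u ^ 2 / 2
      = -x ^ 2 / (2 * 2) + -(u - x / 2) ^ 2 / (2 * (1 / 2)) := by ring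
  rw [e1, e2]

/-- The posterior mean `x/2` halves the frequency, and the posterior variance `1/2` produces the
damping `exp(-(2k)²/4)`. -/
theorem integral_gaussianPDFReal_sub_mul_sin (x k : ℝ) :
    ∫ u, gaussianPDFReal 0 1 (x - u) * Real.sin (2 * k * u) ∂(gaussianReal 0 1)
      = gaussianPDFReal 0 2 x * (Real.exp (-k ^ 2) * Real.sin (k * x)) := by
  rw [integral_gaussianReal_eq_integral_smul one_ne_zero]
  simp only [smul_eq_mul]
  have : ∀ u, gaussianPDFReal 0 1 u * (gaussianPDFReal 0 1 (x - u) * Real.sin (2 * k * u))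
      = gaussianPDFReal 0 2 x * (gaussianPDFReal (x / 2) (1 / 2) u * Real.sin (2 * k * u)) := by
    intro u
    rw [← mul_assoc, ← mul_assoc, mul_comm (gaussianPDFReal 0 1 u),
      gaussianPDFReal_mul_gaussianPDFReal]
  simp only [this]
  have h2 := integral_sin_gaussianReal (x / 2) (1 / 2) (2 * k)
  rw [integral_gaussianReal_eq_integral_smul (by norm_num)] at h2
  simp only [smul_eq_mul] at h2
  rw [integral_const_mul, h2]
  have e1 : -(((1 / 2 : NNReal) : ℝ) * (2 * k) ^ 2 / 2) = -k ^ 2 := by push_cast; ring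
  have e2 : 2 * k * (x / 2) = k * x := by ring
  rw [e1, e2]

theorem integral_gaussianPDFReal_sub (x : ℝ) :
    ∫ u, gaussianPDFReal 0 1 (x - u) ∂(gaussianReal 0 1) = gaussianPDFReal 0 2 x := by
  rw [integral_gaussianReal_eq_integral_smul one_ne_zero]
  have : ∀ u, gaussianPDFReal 0 1 u • gaussianPDFReal 0 1 (x - u)
      = gaussianPDFReal 0 2 x * gaussianPDFReal (x / 2) (1 / 2) u := fun u => by
    rw [smul_eq_mul, mul_comm, gaussianPDFReal_mul_gaussianPDFReal]
  simp only [this]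
  rw [integral_const_mul, integral_gaussianPDFReal_eq_one _ (by norm_num), mul_one]

theorem integral_cos_int_mul (m : ℤ) :
    ∫ x in (-Real.pi)..Real.pi, Real.cos (m * x) = if m = 0 then 2 * Real.pi else 0 := by
  split_ifs with h
  · simp [h]; ring
  · have hm : (m : ℝ) ≠ 0 := by exact_mod_cast h
    rw [intervalIntegral.integral_comp_mul_left _ hm, integral_cos]
    simp [Real.sin_int_mul_pi]

/-- Product-to-sum formula. Frequencies start at 1, so the sum frequency `j + k + 2` never vanishes.
-/
theorem integral_sin_mul_sin_Icc (j k : ℕ) :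
    ∫ x in Set.Icc (-Real.pi) Real.pi, Real.sin (((j : ℝ) + 1) * x) * Real.sin (((k : ℝ) + 1) * x)
      = if j = k then Real.pi else 0 := by
  rw [integral_Icc_eq_integral_Ioc, ← intervalIntegral.integral_of_le (by linarith [Real.pi_pos])]
  have h : ∀ x : ℝ, Real.sin (((j : ℝ) + 1) * x) * Real.sin (((k : ℝ) + 1) * x)
      = 1 / 2 * Real.cos (((j - k : ℤ) : ℝ) * x) - 1 / 2 * Real.cos (((j + k + 2 : ℤ) : ℝ) * x) := by
    intro x
    have e1 : ((j - k : ℤ) : ℝ) * x = ((j : ℝ) + 1) * x - ((k : ℝ) + 1) * x := by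
      push_cast; ring
    have e2 : ((j + k + 2 : ℤ) : ℝ) * x = ((j : ℝ) + 1) * x + ((k : ℝ) + 1) * x := by
      push_cast; ring
    rw [e1, e2, Real.cos_sub, Real.cos_add]; ring
  simp only [h]
  rw [intervalIntegral.integral_sub (Continuous.intervalIntegrable (by fun_prop) _ _)
    (Continuous.intervalIntegrable (by fun_prop) _ _), intervalIntegral.integral_const_mul,
    intervalIntegral.integral_const_mul, integral_cos_int_mul, integral_cos_int_mul,
    if_neg (by omega : ¬ ((j : ℤ) + k + 2 = 0))]
  by_cases hjk : j = k
  · rw [if_pos hjk, if_pos (by omega)]; ring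
  · rw [if_neg hjk, if_neg (by omega)]; ring

end SineIntegrals

/-! ### The hypercube of perturbed Gaussian mixtures -/

section Family

variable {d M : ℕ}

/-- The product of sines with frequencies `j i + 1`. -/
noncomputable def sinProd (j : Fin d → Fin M) (x : Fin d → ℝ) : ℝ :=
  ∏ i, Real.sin ((((j i : ℕ) : ℝ) + 1) * x i)

/-- The subset sum of the functions `sinProd j` selected by `α`. -/
noncomputable def sinSum (α : (Fin d → Fin M) → Bool) (x : Fin d → ℝ) : ℝ :=
  ∑ j, (if α j then 1 else 0) * sinProd j x

/-- The density of the centred Gaussian law with covariance twice the identity. -/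
noncomputable def centralDensity (x : Fin d → ℝ) : ℝ := ∏ i, gaussianPDFReal 0 2 (x i)

/-- The hypercube of densities used for the lower bound. -/
noncomputable def perturbedDensity (b : ℝ) (α : (Fin d → Fin M) → Bool) (x : Fin d → ℝ) : ℝ :=
  centralDensity x * (1 + b * sinSum α x)

/-- The centred Gaussian law with covariance twice the identity. -/
noncomputable def centralLaw (d : ℕ) : Measure (Fin d → ℝ) := Measure.pi fun _ => gaussianReal 0 2

instance isProbabilityMeasure_centralLaw : IsProbabilityMeasure (centralLaw d) := by
  unfold centralLaw; infer_instance

theorem abs_sinProd_le_one (j : Fin d → Fin M) (x : Fin d → ℝ) : |sinProd j x| ≤ 1 := by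
  rw [sinProd, Finset.abs_prod]
  exact Finset.prod_le_one (fun _ _ => abs_nonneg _) fun _ _ => Real.abs_sin_le_one _

@[fun_prop]
theorem continuous_sinProd (j : Fin d → Fin M) : Continuous (sinProd j) := by
  unfold sinProd; fun_prop

@[fun_prop]
theorem continuous_sinSum (α : (Fin d → Fin M) → Bool) : Continuous (sinSum α) := by
  unfold sinSum; fun_prop

theorem abs_sum_ite_mul_le {ι : Type*} [Fintype ι] (α : ι → Bool) (s : ι → ℝ) {c : ℝ}
    (hc : ∀ j, |s j| ≤ c) : |∑ j, (if α j then 1 else 0) * s j| ≤ Fintype.card ι * c := by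
  refine (Finset.abs_sum_le_sum_abs _ _).trans ?_
  have : ∀ j ∈ Finset.univ, |(if α j then 1 else 0) * s j| ≤ c := fun j _ => by
    split_ifs
    · simpa using hc j
    · simpa using (abs_nonneg _).trans (hc j)
  simpa using Finset.sum_le_card_nsmul _ _ _ this

theorem abs_sinSum_le (α : (Fin d → Fin M) → Bool) (x : Fin d → ℝ) :
    |sinSum α x| ≤ (M : ℝ) ^ d := by
  simpa [sinSum] using abs_sum_ite_mul_le α (fun j => sinProd j x) fun j => abs_sinProd_le_one j x

theorem centralDensity_pos (x : Fin d → ℝ) : 0 < centralDensity x :=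
  Finset.prod_pos fun _ _ => gaussianPDFReal_pos _ _ _ (by norm_num)

@[fun_prop]
theorem continuous_centralDensity : Continuous (centralDensity : (Fin d → ℝ) → ℝ) := by
  unfold centralDensity gaussianPDFReal; fun_prop

theorem centralLaw_eq :
    centralLaw d = volume.withDensity fun x => ENNReal.ofReal (centralDensity x) := by
  rw [centralLaw, gaussianReal_of_var_ne_zero 0 (by norm_num)]
  exact pi_withDensity_ofReal volume (integrable_gaussianPDFReal 0 2)
    (gaussianPDFReal_nonneg 0 2)

/-- Each one-dimensional factor is odd under a centred law. At least one coordinate is needed, since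
the empty product is 1. -/
theorem integral_prod_sin_pi_gaussianReal (hd : 1 ≤ d) (v : NNReal) (t : Fin d → ℝ) :
    ∫ u, ∏ i, Real.sin (t i * u i) ∂(Measure.pi fun _ : Fin d => gaussianReal 0 v) = 0 := by
  rw [integral_fintype_prod_eq_prod (fun i u => Real.sin (t i * u))]
  refine Finset.prod_eq_zero (Finset.mem_univ (⟨0, hd⟩ : Fin d)) ?_
  simp [integral_sin_gaussianReal]

theorem integral_sinProd (hd : 1 ≤ d) (j : Fin d → Fin M) :
    ∫ x, sinProd j x ∂(centralLaw d) = 0 :=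
  integral_prod_sin_pi_gaussianReal hd 2 _

/-- The mixing law has density `q` with respect to `N(0, I)`: one plus sines of doubled frequency,
with amplitudes `a j` that exactly undo the damping under smoothing. The condition `hM` bounds the
perturbation by 1, so `q ≥ 0`; the sines have mean zero, so the mass is 1. -/
theorem perturbedDensity_mem (hd : 1 ≤ d) {b : ℝ} (hb : 0 ≤ b)
    (hM : (M : ℝ) ^ d * (b * Real.exp (d * (M : ℝ) ^ 2)) ≤ 1) (α : (Fin d → Fin M) → Bool) :
    perturbedDensity b α ∈ gaussianMixtureClass d := by
  set γ : Measure (Fin d → ℝ) := Measure.pi fun _ => gaussianReal 0 1 with hγ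
  set a : (Fin d → Fin M) → ℝ := fun j => b * Real.exp (∑ i, (((j i : ℕ) : ℝ) + 1) ^ 2) with ha
  set s : (Fin d → Fin M) → (Fin d → ℝ) → ℝ :=
    fun j u => a j * ∏ i, Real.sin (2 * (((j i : ℕ) : ℝ) + 1) * u i) with hs
  set q : (Fin d → ℝ) → ℝ := fun u => 1 + ∑ j, (if α j then 1 else 0) * s j u with hq
  have ha0 : ∀ j, 0 ≤ a j := fun j => by positivity
  have haM : ∀ j, a j ≤ b * Real.exp (d * (M : ℝ) ^ 2) := fun j => by
    simp only [ha]
    gcongr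
    calc ∑ i, (((j i : ℕ) : ℝ) + 1) ^ 2 ≤ ∑ _i : Fin d, (M : ℝ) ^ 2 := by
          gcongr with i _
          exact_mod_cast (j i).2
      _ = d * (M : ℝ) ^ 2 := by simp
  have hsb : ∀ j u, |s j u| ≤ b * Real.exp (d * (M : ℝ) ^ 2) := fun j u => by
    simp only [hs]
    rw [abs_mul, abs_of_nonneg (ha0 j), Finset.abs_prod]
    exact (mul_le_of_le_one_right (ha0 j) (Finset.prod_le_one (fun _ _ => abs_nonneg _)
      fun _ _ => Real.abs_sin_le_one _)).trans (haM j)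
  have hsc : ∀ j, Continuous (s j) := fun j => by simp only [hs]; fun_prop
  have hqc : Continuous q := by simp only [hq]; fun_prop
  have hsum : ∀ u, |∑ j, (if α j then 1 else 0) * s j u| ≤ 1 := fun u =>
    (abs_sum_ite_mul_le α (fun j => s j u) fun j => hsb j u).trans (by simpa using hM)
  have hq0 : ∀ u, 0 ≤ q u := fun u => by
    have := abs_le.1 (hsum u)
    simp only [hq]; linarith
  have hsi : ∀ (g : (Fin d → ℝ) → ℝ) (_ : Integrable g γ) j,
      Integrable (fun u => (if α j then 1 else 0) * (g u * s j u)) γ := fun g hg j =>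
    (hg.mul_bdd (c := b * Real.exp (d * (M : ℝ) ^ 2)) (hsc j).aestronglyMeasurable
      (Filter.Eventually.of_forall (hsb j))).const_mul _
  -- Used twice: with `g = 1` for the total mass, and with a reflected, translated Gaussian for the
  -- mixture density.
  have hint : ∀ g : (Fin d → ℝ) → ℝ, Integrable g γ → Integrable (fun u => g u * q u) γ ∧
      ∫ u, g u * q u ∂γ = (∫ u, g u ∂γ)
        + ∑ j, (if α j then 1 else 0) * ∫ u, g u * s j u ∂γ := fun g hg => by
    have e : ∀ u, g u * q u = g u + ∑ j, (if α j then 1 else 0) * (g u * s j u) := fun u => by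
      simp only [hq, mul_add, mul_one, Finset.mul_sum]
      congr 1
      exact Finset.sum_congr rfl fun j _ => by ring
    have hI := integrable_finsetSum Finset.univ fun j _ => hsi g hg j
    simp only [e]
    refine ⟨hg.add hI, ?_⟩
    rw [integral_add hg hI, integral_finsetSum _ fun j _ => hsi g hg j]
    simp only [integral_const_mul]
  have hone := hint (fun _ => 1) (integrable_const _)
  simp only [one_mul] at hone
  have hs0 : ∀ j, ∫ u, s j u ∂γ = 0 := fun j => by
    simp only [hs]
    rw [integral_const_mul, hγ, integral_prod_sin_pi_gaussianReal hd, mul_zero]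
  refine ⟨γ.withDensity fun u => ENNReal.ofReal (q u), ⟨?_⟩, ?_⟩
  · rw [withDensity_apply _ .univ, setLIntegral_univ, ← ofReal_integral_eq_lintegral_ofReal
      hone.1 (Filter.Eventually.of_forall hq0), hone.2]
    simp [hs0]
  · ext x
    have hgi : Integrable (fun u => gaussianProd (x - u)) γ := integrable_gaussianProd_sub γ x
    have h0 : ∫ u, gaussianProd (x - u) ∂γ = centralDensity x := by
      simp only [gaussianProd, Pi.sub_apply, hγ, centralDensity]
      rw [integral_fintype_prod_eq_prod (fun i u => gaussianPDFReal 0 1 (x i - u))]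
      simp only [integral_gaussianPDFReal_sub]
    have h1 : ∀ j, ∫ u, gaussianProd (x - u) * s j u ∂γ = centralDensity x * (b * sinProd j x) := by
      intro j
      have e : ∀ u, gaussianProd (x - u) * s j u = a j * ∏ i, (gaussianPDFReal 0 1 (x i - u i) *
          Real.sin (2 * (((j i : ℕ) : ℝ) + 1) * u i)) := fun u => by
        simp only [gaussianProd, Pi.sub_apply, hs, Finset.prod_mul_distrib]; ring
      simp only [e]
      rw [integral_const_mul, hγ, integral_fintype_prod_eq_prod (fun i u =>
        gaussianPDFReal 0 1 (x i - u) * Real.sin (2 * (((j i : ℕ) : ℝ) + 1) * u))]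
      simp only [integral_gaussianPDFReal_sub_mul_sin, Finset.prod_mul_distrib, ← Real.exp_sum,
        Finset.sum_neg_distrib, ha, centralDensity, sinProd]
      rw [Real.exp_neg]
      field_simp
    rw [gaussianMixture_eq, integral_withDensity_eq_integral_toReal_smul (by fun_prop)
      (Filter.Eventually.of_forall fun _ => ENNReal.ofReal_lt_top)]
    simp only [ENNReal.toReal_ofReal (hq0 _), smul_eq_mul, mul_comm (q _)]
    rw [(hint _ hgi).2, h0]
    simp only [h1, perturbedDensity, sinSum, mul_add, mul_one, Finset.mul_sum]
    congr 1
    exact Finset.sum_congr rfl fun j _ => by ring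

/-- The sample law of a perturbed density relative to that of the central law. -/
theorem sampleLaw_perturbedDensity (n : ℕ) {b : ℝ} {α : (Fin d → Fin M) → Bool}
    (h0 : ∀ x, 0 ≤ 1 + b * sinSum α x) :
    sampleLaw n (perturbedDensity b α) = (Measure.pi fun _ : Fin n => centralLaw d).withDensity
      fun X => ENNReal.ofReal (∏ i, (1 + b * sinSum α (X i))) := by
  have hi : Integrable (fun x => 1 + b * sinSum α x) (centralLaw d) := by
    refine (integrable_const _).add (Integrable.const_mul ?_ _)
    exact Integrable.of_bound (continuous_sinSum α).aestronglyMeasurable ((M : ℝ) ^ d)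
      (Filter.Eventually.of_forall (abs_sinSum_le α))
  rw [← pi_withDensity_ofReal (centralLaw d) hi h0, sampleLaw, centralLaw_eq,
    ← withDensity_mul _ (by fun_prop) (by fun_prop)]
  congr! 4
  simp only [perturbedDensity, Pi.mul_apply]
  rw [ENNReal.ofReal_mul (centralDensity_pos _).le]

end Family

/-! ### Separation and chi-square closeness of the hypercube -/

section LowerBound

variable {d M : ℕ}

theorem integral_sinProd_mul_sinProd (j k : Fin d → Fin M) :
    ∫ x in Set.Icc (fun _ : Fin d => -Real.pi) (fun _ => Real.pi), sinProd j x * sinProd k x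
      = if j = k then Real.pi ^ d else 0 := by
  have e : ∀ x : Fin d → ℝ, sinProd j x * sinProd k x = ∏ i,
      (Real.sin ((((j i : ℕ) : ℝ) + 1) * x i) * Real.sin ((((k i : ℕ) : ℝ) + 1) * x i)) :=
    fun x => by simp only [sinProd, Finset.prod_mul_distrib]
  simp only [e]
  rw [← Set.pi_univ_Icc, volume_pi, Measure.restrict_pi_pi,
    integral_fintype_prod_eq_prod (fun i x =>
      Real.sin ((((j i : ℕ) : ℝ) + 1) * x) * Real.sin ((((k i : ℕ) : ℝ) + 1) * x))]
  simp only [integral_sin_mul_sin_Icc]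
  split_ifs with h
  · simp [h]
  · obtain ⟨i, hi⟩ := Function.ne_iff.1 h
    refine Finset.prod_eq_zero (Finset.mem_univ i) (if_neg fun h => hi (Fin.ext h))

/-- The coefficient of `sinProd j` in `g / centralDensity - 1` on the cube `[-π, π]^d`. -/
noncomputable def sinCoeff (j : Fin d → Fin M) (g : (Fin d → ℝ) → ℝ) : ℝ :=
  (Real.pi ^ d)⁻¹ * ∫ x in Set.Icc (fun _ : Fin d => -Real.pi) (fun _ => Real.pi),
    (g x / centralDensity x - 1) * sinProd j x

/-- The squared `L²` loss controls the error in the coefficients of the perturbation. -/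
theorem exists_sqL2Loss_ge (d : ℕ) : ∃ A : ℝ, 0 < A ∧ ∀ (M : ℕ) (b : ℝ)
    (α : (Fin d → Fin M) → Bool) (g : (Fin d → ℝ) → ℝ), Measurable g →
    ENNReal.ofReal (A * ∑ j, (sinCoeff j g - b * (if α j then 1 else 0)) ^ 2)
      ≤ sqL2Loss g (perturbedDensity b α) := by
  set box := Set.Icc (fun _ : Fin d => -Real.pi) (fun _ => Real.pi) with hbox
  have hpi := Real.pi_pos
  -- On the compact cube the central density is at least `m > 0`, so dividing by it costs only a
  -- constant depending on `d`.
  obtain ⟨x₀, -, hx₀⟩ := (isCompact_Icc : IsCompact box).exists_isMinOn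
    (Set.nonempty_Icc.2 fun _ => by simp; linarith) continuous_centralDensity.continuousOn
  set m := centralDensity x₀ with hm
  have hm0 : 0 < m := centralDensity_pos x₀
  have hmle : ∀ x ∈ box, m ≤ centralDensity x := fun x hx => hx₀ hx
  refine ⟨m ^ 2 * Real.pi ^ d, by positivity, fun M b α g hg => ?_⟩
  -- An estimate may have infinite loss, where nothing is to prove; otherwise the difference `D` is
  -- in `L²`.
  by_cases htop : sqL2Loss g (perturbedDensity b α) = ∞
  · rw [htop]; exact le_top
  have hfc : Continuous (perturbedDensity b α) := by unfold perturbedDensity; fun_prop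
  set D : (Fin d → ℝ) → ℝ := fun x => g x - perturbedDensity b α x with hD
  have hDm : Measurable D := hg.sub hfc.measurable
  have hDsq : Integrable (fun x => D x ^ 2) := by
    refine ⟨(hDm.pow_const 2).aestronglyMeasurable, ?_⟩
    rw [hasFiniteIntegral_iff_ofReal (Filter.Eventually.of_forall fun x => sq_nonneg _)]
    exact lt_top_iff_ne_top.2 htop
  have hDL : MemLp D 2 := (memLp_two_iff_integrable_sq hDm.aestronglyMeasurable).2 hDsq
  have hboxm : MeasurableSet box := measurableSet_Icc
  set ν := (volume : Measure (Fin d → ℝ)).restrict box with hν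
  have hνfin : IsFiniteMeasure ν := ⟨by
    rw [hν, Measure.restrict_apply_univ]; exact isCompact_Icc.measure_lt_top⟩
  have hcm : Measurable (centralDensity : (Fin d → ℝ) → ℝ) := continuous_centralDensity.measurable
  set h : (Fin d → ℝ) → ℝ := fun x => D x / centralDensity x with hh
  have hle : ∀ᵐ x ∂ν, ‖h x‖ ≤ m⁻¹ * ‖D x‖ := by
    filter_upwards [ae_restrict_mem hboxm] with x hx
    simp only [hh]
    rw [norm_div, Real.norm_of_nonneg (centralDensity_pos x).le, inv_mul_eq_div]
    exact div_le_div_of_nonneg_left (norm_nonneg _) hm0 (hmle x hx)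
  have hhL : MemLp h 2 ν := MemLp.of_le_mul (hDL.restrict box)
    (hDm.div hcm).aestronglyMeasurable hle
  have heL : ∀ j : Fin d → Fin M, MemLp (sinProd j) 2 ν := fun j =>
    MemLp.of_bound (continuous_sinProd j).aestronglyMeasurable 1
      (Filter.Eventually.of_forall (abs_sinProd_le_one j))
  have hSL : MemLp (sinSum α) 2 ν :=
    MemLp.of_bound (continuous_sinSum α).aestronglyMeasurable ((M : ℝ) ^ d)
      (Filter.Eventually.of_forall (abs_sinSum_le α))
  have hSe : ∀ j, ∫ x, sinSum α x * sinProd j x ∂ν = (if α j then 1 else 0) * Real.pi ^ d := by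
    intro j
    have e : ∀ x, sinSum α x * sinProd j x
        = ∑ k, (if α k then 1 else 0) * (sinProd k x * sinProd j x) := fun x => by
      rw [sinSum, Finset.sum_mul]
      exact Finset.sum_congr rfl fun k _ => by ring
    simp only [e]
    have hkj : ∀ k, Integrable (fun x => sinProd k x * sinProd j x) ν := fun k =>
      (heL k).integrable_mul (heL j)
    rw [integral_finsetSum _ fun k _ => (hkj k).const_mul _]
    simp only [integral_const_mul, hν, hbox, integral_sinProd_mul_sinProd]
    simp
  -- Dividing by the central density gives `g / centralDensity - 1 = h + b * sinSum α`, so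
  -- coefficient errors are the sine coefficients of `h`, to which Bessel applies.
  have hcoef : ∀ j, ∫ x, h x * sinProd j x ∂ν
      = Real.pi ^ d * (sinCoeff j g - b * (if α j then 1 else 0)) := fun j => by
    have e : ∀ x, (g x / centralDensity x - 1) * sinProd j x
        = h x * sinProd j x + b * (sinSum α x * sinProd j x) := fun x => by
      have := (centralDensity_pos x).ne'
      simp only [hh, hD, perturbedDensity]
      field_simp
      ring
    rw [sinCoeff]
    simp only [e]
    have h1 : Integrable (fun x => h x * sinProd j x) ν := hhL.integrable_mul (heL j)
    have h2 : Integrable (fun x => sinSum α x * sinProd j x) ν := hSL.integrable_mul (heL j)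
    rw [← hν, integral_add h1 (h2.const_mul b), integral_const_mul, hSe j]
    field_simp
    ring
  have hbes := sum_sq_integral_mul_le (κ := Real.pi ^ d) (by positivity) heL
    integral_sinProd_mul_sinProd hhL
  simp only [hcoef, mul_pow, ← Finset.mul_sum] at hbes
  have hh2 : ∫ x, h x ^ 2 ∂ν ≤ (m ^ 2)⁻¹ * ∫ x, D x ^ 2 := by
    calc ∫ x, h x ^ 2 ∂ν ≤ ∫ x, (m ^ 2)⁻¹ * D x ^ 2 ∂ν := by
          refine integral_mono_ae hhL.integrable_sq (hDsq.restrict.const_mul _) ?_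
          filter_upwards [hle] with x hx
          have := pow_le_pow_left₀ (norm_nonneg _) hx 2
          simpa [mul_pow] using this
      _ = (m ^ 2)⁻¹ * ∫ x, D x ^ 2 ∂ν := integral_const_mul _ _
      _ ≤ _ := by
          exact mul_le_mul_of_nonneg_left (setIntegral_le_integral hDsq
            (Filter.Eventually.of_forall fun x => sq_nonneg _)) (by positivity)
  have hloss : sqL2Loss g (perturbedDensity b α) = ENNReal.ofReal (∫ x, D x ^ 2) :=
    (ofReal_integral_eq_lintegral_ofReal hDsq
      (Filter.Eventually.of_forall fun x => sq_nonneg _)).symm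
  rw [hloss]
  refine ENNReal.ofReal_le_ofReal ?_
  set err := ∑ j, (sinCoeff j g - b * (if α j then 1 else 0)) ^ 2
  have hP : 0 < Real.pi ^ d := by positivity
  have h3 : Real.pi ^ d * err ≤ ∫ x, h x ^ 2 ∂ν := by
    have : Real.pi ^ d * (Real.pi ^ d * err) ≤ Real.pi ^ d * ∫ x, h x ^ 2 ∂ν := by
      rw [← mul_assoc, ← sq]; exact hbes
    exact le_of_mul_le_mul_left this hP
  calc m ^ 2 * Real.pi ^ d * err = m ^ 2 * (Real.pi ^ d * err) := by ring
    _ ≤ m ^ 2 * ((m ^ 2)⁻¹ * ∫ x, D x ^ 2) := by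
        exact mul_le_mul_of_nonneg_left (h3.trans hh2) (sq_nonneg m)
    _ = _ := by field_simp

theorem measurable_sinCoeff {n : ℕ} {fhat : (Fin n → Fin d → ℝ) → (Fin d → ℝ) → ℝ}
    (hf : IsEstimator fhat) (j : Fin d → Fin M) : Measurable fun X => sinCoeff j (fhat X) := by
  have hf' : Measurable (fun p : (Fin n → Fin d → ℝ) × (Fin d → ℝ) => fhat p.1 p.2) := hf
  have hcm : Measurable (centralDensity : (Fin d → ℝ) → ℝ) := continuous_centralDensity.measurable
  have hsm : Measurable (sinProd j) := (continuous_sinProd j).measurable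
  have h : StronglyMeasurable (fun p : (Fin n → Fin d → ℝ) × (Fin d → ℝ) =>
      (fhat p.1 p.2 / centralDensity p.2 - 1) * sinProd j p.2) := by
    apply Measurable.stronglyMeasurable; fun_prop
  exact h.integral_prod_right.measurable.const_mul _

theorem one_add_mul_sinSum_mem {b : ℝ} (hb : 0 ≤ b) (hM : (M : ℝ) ^ d * b ≤ 1 / 2)
    (α : (Fin d → Fin M) → Bool) (x : Fin d → ℝ) :
    1 / 2 ≤ 1 + b * sinSum α x ∧ 1 + b * sinSum α x ≤ 3 / 2 := by
  have h := abs_le.1 (abs_sinSum_le α x)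
  constructor <;> nlinarith

theorem integral_one_add_mul_sinSum (hd : 1 ≤ d) (b : ℝ) (α : (Fin d → Fin M) → Bool) :
    ∫ x, (1 + b * sinSum α x) ∂(centralLaw d) = 1 := by
  have hi : ∀ j : Fin d → Fin M, Integrable (sinProd j) (centralLaw d) := fun j =>
    Integrable.of_bound (continuous_sinProd j).aestronglyMeasurable 1
      (Filter.Eventually.of_forall (abs_sinProd_le_one j))
  have hS : ∫ x, sinSum α x ∂(centralLaw d) = 0 := by
    simp only [sinSum]
    rw [integral_finsetSum _ fun j _ => (hi j).const_mul _]
    simp only [integral_const_mul, integral_sinProd hd, mul_zero, Finset.sum_const_zero]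
  have hSi : Integrable (sinSum α) (centralLaw d) :=
    Integrable.of_bound (continuous_sinSum α).aestronglyMeasurable ((M : ℝ) ^ d)
      (Filter.Eventually.of_forall (abs_sinSum_le α))
  rw [integral_add (integrable_const _) (hSi.const_mul b), integral_const_mul, hS]
  simp

theorem sinSum_update {α : (Fin d → Fin M) → Bool} {j : Fin d → Fin M} (hj : α j = false)
    (x : Fin d → ℝ) : sinSum (Function.update α j true) x = sinSum α x + sinProd j x := by
  simp only [sinSum]
  rw [← Finset.add_sum_erase _ _ (Finset.mem_univ j),
    ← Finset.add_sum_erase (f := fun k => (if α k then 1 else 0) * sinProd k x) _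
      (Finset.mem_univ j)]
  have : ∀ k ∈ Finset.univ.erase j, (if Function.update α j true k then (1 : ℝ) else 0) * sinProd k x
      = (if α k then 1 else 0) * sinProd k x := fun k hk => by
    rw [Function.update_of_ne (Finset.ne_of_mem_erase hk)]
  rw [Finset.sum_congr rfl this]
  simp [hj]
  ring

/-- Chi-square bound for neighbouring vertices of the hypercube. -/
theorem integral_likelihood_sq_div_le (hd : 1 ≤ d) {b : ℝ} (hb : 0 ≤ b)
    (hM : (M : ℝ) ^ d * b ≤ 1 / 2) {α : (Fin d → Fin M) → Bool} {j : Fin d → Fin M}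
    (hj : α j = false) :
    ∫ x, (1 + b * sinSum (Function.update α j true) x) ^ 2 / (1 + b * sinSum α x) ∂(centralLaw d)
      ≤ 1 + 2 * b ^ 2 := by
  have hei : Integrable (sinProd j) (centralLaw d) :=
    Integrable.of_bound (continuous_sinProd j).aestronglyMeasurable 1
      (Filter.Eventually.of_forall (abs_sinProd_le_one j))
  have hki : Integrable (fun x => 1 + b * sinSum α x) (centralLaw d) := by
    refine (integrable_const _).add (Integrable.const_mul ?_ _)
    exact Integrable.of_bound (continuous_sinSum α).aestronglyMeasurable ((M : ℝ) ^ d)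
      (Filter.Eventually.of_forall (abs_sinSum_le α))
  have hri : Integrable (fun x => (1 + b * sinSum α x) + 2 * b * sinProd j x) (centralLaw d) :=
    hki.add (hei.const_mul _)
  -- With `k = 1 + b * sinSum α x` and `e = sinProd j x`, the ratio is `k + 2be + b²e²/k`, and `k ≥
  -- 1/2`, `|e| ≤ 1` bound the last term by `2b²`.
  calc _ ≤ ∫ x, ((1 + b * sinSum α x) + 2 * b * sinProd j x + 2 * b ^ 2) ∂(centralLaw d) := by
        refine integral_mono_of_nonneg (Filter.Eventually.of_forall fun x => ?_)
          (hri.add (integrable_const _)) (Filter.Eventually.of_forall fun x => ?_)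
        · have := (one_add_mul_sinSum_mem hb hM α x).1
          exact div_nonneg (sq_nonneg _) (by linarith)
        · have h1 := (one_add_mul_sinSum_mem hb hM α x).1
          have h2 := abs_le.1 (abs_sinProd_le_one j x)
          simp only [sinSum_update hj]
          rw [div_le_iff₀ (by linarith)]
          have h3 : sinProd j x ^ 2 ≤ 1 := by nlinarith
          have h4 : b ^ 2 * sinProd j x ^ 2 ≤ b ^ 2 := mul_le_of_le_one_right (sq_nonneg _) h3
          nlinarith [mul_le_mul_of_nonneg_left h1 (sq_nonneg b)]
    _ = 1 + 2 * b ^ 2 := by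
        rw [integral_add hri (integrable_const _), integral_add hki (hei.const_mul _),
          integral_one_add_mul_sinSum hd, integral_const_mul, integral_sinProd hd]
        simp

end LowerBound

/-! ### Assouad's argument and the choice of parameters -/

section Assouad

variable {d M : ℕ}

/-- Flipping one coordinate of a vertex of the hypercube. -/
def flipAt {ι : Type*} [DecidableEq ι] (j : ι) (α : ι → Bool) : ι → Bool :=
  Function.update α j (!α j)

theorem flipAt_involutive {ι : Type*} [DecidableEq ι] (j : ι) :
    Function.Involutive (flipAt j) := fun α => by
  simp [flipAt]

/-- Risk of a statistic `T` for the `j`-th coordinate of the hypercube. -/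
noncomputable def coordRisk {n : ℕ} (b : ℝ) (T : (Fin n → Fin d → ℝ) → ℝ) (j : Fin d → Fin M)
    (α : (Fin d → Fin M) → Bool) : ℝ≥0∞ :=
  ∫⁻ X, ENNReal.ofReal ((T X - b * (if α j then 1 else 0)) ^ 2)
    ∂(sampleLaw n (perturbedDensity b α))

/-- Relative to `n` draws from the central law, neighbouring vertices have product likelihoods. The
chi-square integral tensorises to at most `(1 + 2b²)^n ≤ exp(2nb²) ≤ e ≤ 3`, as
`two_point_lower_bound` requires. -/
theorem coordRisk_add_coordRisk_update_ge (hd : 1 ≤ d) {n : ℕ} {b : ℝ} (hb : 0 ≤ b)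
    (hM : (M : ℝ) ^ d * b ≤ 1 / 2) (hbn : 2 * n * b ^ 2 ≤ 1)
    {T : (Fin n → Fin d → ℝ) → ℝ} (hT : Measurable T)
    {α : (Fin d → Fin M) → Bool} {j : Fin d → Fin M} (hj : α j = false) :
    ENNReal.ofReal (b ^ 2 / 4)
      ≤ coordRisk b T j α + coordRisk b T j (Function.update α j true) := by
  have hk := fun (β : (Fin d → Fin M) → Bool) x => one_add_mul_sinSum_mem hb hM β x
  have hk0 : ∀ (β : (Fin d → Fin M) → Bool) x, 0 < 1 + b * sinSum β x := fun β x => by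
    linarith [(hk β x).1]
  set w : ((Fin d → Fin M) → Bool) → (Fin n → Fin d → ℝ) → ℝ :=
    fun β X => ∏ i, (1 + b * sinSum β (X i)) with hw
  have hwc : ∀ β, Continuous (w β) := fun β => by simp only [hw]; fun_prop
  have hw0 : ∀ β X, 0 < w β X := fun β X => Finset.prod_pos fun i _ => hk0 β _
  have hlint : ∀ β (t : (Fin n → Fin d → ℝ) → ℝ), Measurable t →
      ∫⁻ X, ENNReal.ofReal (t X ^ 2) ∂(sampleLaw n (perturbedDensity b β))
        = ∫⁻ X, ENNReal.ofReal (w β X) * ENNReal.ofReal (t X ^ 2)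
          ∂(Measure.pi fun _ : Fin n => centralLaw d) := fun β t ht => by
    rw [sampleLaw_perturbedDensity n fun x => (hk0 β x).le,
      lintegral_withDensity_eq_lintegral_mul _ (hwc β).measurable.ennreal_ofReal (by fun_prop)]
    rfl
  simp only [coordRisk]
  rw [hlint α _ (by fun_prop), hlint _ _ (by fun_prop)]
  simp only [hj, Function.update_self, if_true, mul_one, Bool.false_eq_true, if_false, mul_zero,
    sub_zero]
  set α' := Function.update α j true with hα'
  have hi1 : Integrable (fun x => 1 + b * sinSum α' x) (centralLaw d) :=
    Integrable.of_bound (Continuous.aestronglyMeasurable (by fun_prop)) (3 / 2)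
      (Filter.Eventually.of_forall fun x => by
        rw [Real.norm_of_nonneg (hk0 α' x).le]; exact (hk α' x).2)
  have hi2 : Integrable (fun x => (1 + b * sinSum α' x) ^ 2 / (1 + b * sinSum α x))
      (centralLaw d) := by
    have hc : Continuous (fun x : Fin d → ℝ => (1 + b * sinSum α' x) ^ 2 / (1 + b * sinSum α x)) :=
      Continuous.div (by fun_prop) (by fun_prop) fun x => (hk0 α x).ne'
    refine Integrable.of_bound hc.aestronglyMeasurable ((3 / 2) ^ 2 / (1 / 2))
      (Filter.Eventually.of_forall fun x => ?_)
    have h1 := hk α' x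
    have h2 := hk α x
    have h3 := hk0 α x
    have h4 := hk0 α' x
    rw [Real.norm_of_nonneg (by positivity)]
    gcongr
    · exact h1.2
    · exact h2.1
  have hsq : ∀ X, w α' X ^ 2 / w α X
      = ∏ i, ((1 + b * sinSum α' (X i)) ^ 2 / (1 + b * sinSum α (X i))) := fun X => by
    simp only [hw, Finset.prod_div_distrib, Finset.prod_pow]
  refine two_point_lower_bound (Q := Measure.pi fun _ : Fin n => centralLaw d) b
    (hwc α).measurable hT (hw0 α) (fun X => (hw0 α' X).le) ?_ ?_ ?_ ?_
  · exact Integrable.fintype_prod fun _ => hi1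
  · simp only [hsq]
    exact Integrable.fintype_prod (f := fun _ x =>
      (1 + b * sinSum α' x) ^ 2 / (1 + b * sinSum α x)) fun _ => hi2
  · simp only [hw]
    rw [integral_fintype_prod_eq_pow (fun x => 1 + b * sinSum α' x),
      integral_one_add_mul_sinSum hd, one_pow]
  · simp only [hsq]
    rw [integral_fintype_prod_eq_pow (fun x =>
      (1 + b * sinSum α' x) ^ 2 / (1 + b * sinSum α x)), Fintype.card_fin]
    calc _ ≤ (1 + 2 * b ^ 2) ^ n := by
          refine pow_le_pow_left₀ (integral_nonneg fun x => ?_)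
            (integral_likelihood_sq_div_le hd hb hM hj) n
          exact div_nonneg (sq_nonneg _) (hk0 α x).le
      _ ≤ Real.exp (2 * b ^ 2) ^ n := by
          gcongr
          linarith [Real.add_one_le_exp (2 * b ^ 2)]
      _ = Real.exp (2 * n * b ^ 2) := by rw [← Real.exp_nat_mul]; congr 1; ring
      _ ≤ Real.exp 1 := Real.exp_le_exp.2 hbn
      _ ≤ 3 := by linarith [Real.exp_one_lt_d9]

theorem coordRisk_add_coordRisk_flipAt_ge (hd : 1 ≤ d) {n : ℕ} {b : ℝ} (hb : 0 ≤ b)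
    (hM : (M : ℝ) ^ d * b ≤ 1 / 2) (hbn : 2 * n * b ^ 2 ≤ 1)
    {T : (Fin n → Fin d → ℝ) → ℝ} (hT : Measurable T)
    (α : (Fin d → Fin M) → Bool) (j : Fin d → Fin M) :
    ENNReal.ofReal (b ^ 2 / 4) ≤ coordRisk b T j α + coordRisk b T j (flipAt j α) := by
  cases hj : α j with
  | false =>
    have := coordRisk_add_coordRisk_update_ge hd hb hM hbn hT hj
    simpa [flipAt, hj] using this
  | true =>
    have h := coordRisk_add_coordRisk_update_ge hd hb hM hbn hT (α := flipAt j α) (j := j)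
      (by simp [flipAt, hj])
    have e : Function.update (flipAt j α) j true = α := by
      rw [flipAt, Function.update_idem, ← hj, Function.update_eq_self]
    rw [e] at h
    rwa [add_comm]

/-- Assouad's bound over the hypercube of perturbed densities. -/
theorem exists_hypercube_risk_ge (d : ℕ) (hd : 1 ≤ d) : ∃ A : ℝ, 0 < A ∧
    ∀ (n M : ℕ) (b : ℝ), 0 ≤ b → (M : ℝ) ^ d * (b * Real.exp (d * (M : ℝ) ^ 2)) ≤ 1 / 2 →
      2 * n * b ^ 2 ≤ 1 →
      ENNReal.ofReal (A * (M : ℝ) ^ d * b ^ 2)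
        ≤ densityMinimaxRisk n (gaussianMixtureClass d) sqL2Loss := by
  obtain ⟨A, hA, hloss⟩ := exists_sqL2Loss_ge d
  -- The two-point constant `1/4`, halved because it bounds the sum of the risks at two vertices.
  refine ⟨A / 8, by positivity, fun n M b hb hM hbn => ?_⟩
  refine le_iInf₂ fun fhat hf => ?_
  set s : ℝ≥0∞ := ⨆ f ∈ gaussianMixtureClass d, ∫⁻ X, sqL2Loss (fhat X) f ∂(sampleLaw n f) with hs
  have hM' : (M : ℝ) ^ d * b ≤ 1 / 2 := by
    refine le_trans ?_ hM
    gcongr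
    exact le_mul_of_one_le_right hb (Real.one_le_exp (by positivity))
  set T : (Fin d → Fin M) → (Fin n → Fin d → ℝ) → ℝ := fun j X => sinCoeff j (fhat X) with hT
  have hTm : ∀ j, Measurable (T j) := fun j => measurable_sinCoeff hf j
  have hvertex : ∀ α : (Fin d → Fin M) → Bool,
      ENNReal.ofReal A * ∑ j, coordRisk b (T j) j α ≤ s := fun α => by
    have hmem := perturbedDensity_mem hd hb (hM.trans (by norm_num)) α
    refine le_trans ?_ (le_iSup₂ (f := fun f (_ : f ∈ gaussianMixtureClass d) =>
      ∫⁻ X, sqL2Loss (fhat X) f ∂(sampleLaw n f)) _ hmem)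
    simp only [coordRisk]
    have hm : ∀ j, Measurable (fun X =>
        ENNReal.ofReal ((T j X - b * (if α j then 1 else 0)) ^ 2)) := fun j => by
      have := hTm j
      fun_prop
    rw [← lintegral_finsetSum _ fun j _ => hm j,
      ← lintegral_const_mul _ (Finset.measurable_sum _ fun j _ => hm j)]
    refine lintegral_mono fun X => ?_
    refine le_trans (le_of_eq ?_) (hloss M b α (fhat X) (hf.comp measurable_prodMk_left))
    rw [ENNReal.ofReal_mul hA.le, ENNReal.ofReal_sum_of_nonneg fun j _ => sq_nonneg _]
  -- Flipping coordinate `j` permutes the vertices, so summing the pair bound over all vertices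
  -- counts each risk twice.
  have hpair : ∀ j : Fin d → Fin M,
      (Fintype.card ((Fin d → Fin M) → Bool) : ℝ≥0∞) * ENNReal.ofReal (b ^ 2 / 4)
        ≤ 2 * ∑ α, coordRisk b (T j) j α := fun j => by
    have h1 : ∑ α, coordRisk b (T j) j (flipAt j α) = ∑ α, coordRisk b (T j) j α :=
      Equiv.sum_comp (flipAt_involutive j).toPerm (fun α => coordRisk b (T j) j α)
    calc _ = ∑ _α : (Fin d → Fin M) → Bool, ENNReal.ofReal (b ^ 2 / 4) := by
          rw [Finset.sum_const, Finset.card_univ, nsmul_eq_mul]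
      _ ≤ ∑ α, (coordRisk b (T j) j α + coordRisk b (T j) j (flipAt j α)) :=
          Finset.sum_le_sum fun α _ =>
            coordRisk_add_coordRisk_flipAt_ge hd hb hM' hbn (hTm j) α j
      _ = _ := by rw [Finset.sum_add_distrib, h1, two_mul]
  set N : ℝ≥0∞ := (Fintype.card ((Fin d → Fin M) → Bool) : ℝ≥0∞) with hN
  have hN0 : N ≠ 0 := by simp [hN]
  have hNt : N ≠ ∞ := ENNReal.natCast_ne_top _
  -- The supremum dominates the average over vertices; the factor `N` is kept on both sides and
  -- cancelled afterwards.
  have hmain : N * (ENNReal.ofReal A * ((M : ℝ≥0∞) ^ d * ENNReal.ofReal (b ^ 2 / 4)))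
      ≤ N * (2 * s) := by
    calc _ = ENNReal.ofReal A * ∑ _j : Fin d → Fin M, N * ENNReal.ofReal (b ^ 2 / 4) := by
          rw [Finset.sum_const, Finset.card_univ, nsmul_eq_mul]
          simp only [Fintype.card_pi, Fintype.card_fin, Finset.prod_const, Finset.card_univ,
            Nat.cast_pow]
          ring
      _ ≤ ENNReal.ofReal A * ∑ j, 2 * ∑ α, coordRisk b (T j) j α :=
          mul_le_mul_right (Finset.sum_le_sum fun j _ => hpair j) _
      _ = 2 * ∑ α, ENNReal.ofReal A * ∑ j, coordRisk b (T j) j α := by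
          rw [← Finset.mul_sum, ← Finset.mul_sum, Finset.sum_comm]
          ring
      _ ≤ 2 * ∑ _α : (Fin d → Fin M) → Bool, s := by
          gcongr with α _
          exact hvertex α
      _ = _ := by rw [Finset.sum_const, Finset.card_univ, nsmul_eq_mul]; ring
  have h2 := (ENNReal.mul_le_mul_iff_right hN0 hNt).1 hmain
  have h3 : ENNReal.ofReal A * ((M : ℝ≥0∞) ^ d * ENNReal.ofReal (b ^ 2 / 4))
      = 2 * ENNReal.ofReal (A / 8 * (M : ℝ) ^ d * b ^ 2) := by
    have e1 : (M : ℝ≥0∞) ^ d = ENNReal.ofReal ((M : ℝ) ^ d) := by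
      rw [ENNReal.ofReal_pow (by positivity), ENNReal.ofReal_natCast]
    have e2 : (2 : ℝ≥0∞) = ENNReal.ofReal 2 := by simp
    rw [e1, e2, ← ENNReal.ofReal_mul (by positivity), ← ENNReal.ofReal_mul (by positivity),
      ← ENNReal.ofReal_mul (by positivity)]
    congr 1; ring
  rw [h3] at h2
  exact (ENNReal.mul_le_mul_iff_right two_ne_zero (by norm_num)).1 h2

end Assouad

/-- Lower bound on the minimax risk over Gaussian mixtures. -/
theorem exists_le_minimaxRisk (d : ℕ) (hd : 1 ≤ d) : ∃ c : ℝ, 0 < c ∧ ∀ n : ℕ, 2 ≤ n →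
    ENNReal.ofReal (c * (Real.log n ^ ((d : ℝ) / 2) / n))
      ≤ densityMinimaxRisk n (gaussianMixtureClass d) sqL2Loss := by
  obtain ⟨A, hA, h⟩ := exists_hypercube_risk_ge d hd
  have hd0 : (0 : ℝ) < d := by exact_mod_cast hd
  -- Chosen to cancel the factor `exp(4d)` in `e2` and leave `1/2`.
  set κ : ℝ := Real.exp (-(4 * d)) / 2 with hκ
  have hκ0 : 0 < κ := by positivity
  have hκ1 : κ ≤ 1 / 2 := by
    have : Real.exp (-(4 * d)) ≤ 1 := Real.exp_le_one_iff.2 (by linarith)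
    rw [hκ]; linarith
  refine ⟨A * κ ^ 2 / √(8 * d) ^ d, by positivity, fun n hn => ?_⟩
  have hn0 : (0 : ℝ) < n := by positivity
  have hln : 0 < Real.log n := Real.log_pos (by exact_mod_cast hn)
  -- With `8dr² = log n` and `M² ≤ 2 + 2r²`, one gets `exp(2dM²) ≤ exp(4d) √n`, which is what `b =
  -- κ/√n` can offset.
  set r : ℝ := √(Real.log n) / √(8 * d) with hr
  have hr0 : 0 ≤ r := by positivity
  have hr2 : 8 * d * r ^ 2 = Real.log n := by
    rw [hr, div_pow, Real.sq_sqrt hln.le, Real.sq_sqrt (by positivity)]; field_simp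
  set M : ℕ := ⌊r⌋₊ + 1 with hM
  have hM1 : r ≤ M := by
    rw [hM]; push_cast; exact (Nat.lt_floor_add_one r).le
  have hM2 : (M : ℝ) ≤ r + 1 := by
    rw [hM]; push_cast; linarith [Nat.floor_le hr0]
  set b : ℝ := κ / √n with hb
  have hb0 : 0 ≤ b := by positivity
  have hb2 : b ^ 2 = κ ^ 2 / n := by rw [hb, div_pow, Real.sq_sqrt hn0.le]
  have hMsq : (M : ℝ) ^ 2 ≤ 2 + 2 * r ^ 2 := by nlinarith [sq_nonneg (r - 1)]
  -- This absorbs the number `M^d` of perturbations into a second factor `exp(dM²)`.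
  have hMexp : (M : ℝ) ≤ Real.exp ((M : ℝ) ^ 2) := by
    nlinarith [Real.add_one_le_exp ((M : ℝ) ^ 2), sq_nonneg ((M : ℝ) - 1)]
  have hcond : (M : ℝ) ^ d * (b * Real.exp (d * (M : ℝ) ^ 2)) ≤ 1 / 2 := by
    have e1 : (M : ℝ) ^ d ≤ Real.exp (d * (M : ℝ) ^ 2) := by
      rw [Real.exp_nat_mul]; gcongr
    have e2 : Real.exp (d * (M : ℝ) ^ 2) * Real.exp (d * (M : ℝ) ^ 2)
        ≤ Real.exp (4 * d) * √n := by
      have : √(n : ℝ) = Real.exp (Real.log n / 2) := by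
        rw [Real.exp_half, Real.exp_log hn0]
      rw [this, ← Real.exp_add, ← Real.exp_add, Real.exp_le_exp, ← hr2]
      nlinarith [mul_le_mul_of_nonneg_left hMsq hd0.le]
    calc (M : ℝ) ^ d * (b * Real.exp (d * (M : ℝ) ^ 2))
        ≤ Real.exp (d * (M : ℝ) ^ 2) * (b * Real.exp (d * (M : ℝ) ^ 2)) := by gcongr
      _ = b * (Real.exp (d * (M : ℝ) ^ 2) * Real.exp (d * (M : ℝ) ^ 2)) := by ring
      _ ≤ b * (Real.exp (4 * d) * √n) := by gcongr
      _ = 1 / 2 := by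
        rw [hb, hκ, Real.exp_neg]
        have : 0 < √(n : ℝ) := Real.sqrt_pos.2 hn0
        field_simp
  have hbn : 2 * n * b ^ 2 ≤ 1 := by
    rw [hb2]
    have : 2 * n * (κ ^ 2 / n) = 2 * κ ^ 2 := by field_simp
    rw [this]; nlinarith
  refine le_trans (ENNReal.ofReal_le_ofReal ?_) (h n M b hb0 hcond hbn)
  have hlog : Real.log n ^ ((d : ℝ) / 2) = √(Real.log n) ^ d := by
    rw [Real.sqrt_eq_rpow, ← Real.rpow_natCast, ← Real.rpow_mul hln.le]; congr 1; ring
  calc A * κ ^ 2 / √(8 * d) ^ d * (Real.log n ^ ((d : ℝ) / 2) / n)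
      = A * r ^ d * b ^ 2 := by rw [hlog, hb2, hr, div_pow]; ring
    _ ≤ A * (M : ℝ) ^ d * b ^ 2 := by gcongr

theorem theorem2p1 (d : ℕ) (hd : 1 ≤ d) :
    ∃ c C : ℝ, 0 < c ∧ 0 < C ∧ ∀ n : ℕ, 2 ≤ n →
      ENNReal.ofReal (c * (Real.log n ^ ((d : ℝ) / 2) / n))
          ≤ densityMinimaxRisk n (gaussianMixtureClass d) sqL2Loss ∧
        densityMinimaxRisk n (gaussianMixtureClass d) sqL2Loss
          ≤ ENNReal.ofReal (C * (Real.log n ^ ((d : ℝ) / 2) / n)) := by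
  obtain ⟨c, hc, hlow⟩ := exists_le_minimaxRisk d hd
  obtain ⟨C, hC, hup⟩ := exists_minimaxRisk_le d
  exact ⟨c, C, hc, hC, fun n hn => ⟨hlow n hn, hup n hn⟩⟩
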